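/- **Setting.** Let $\mathbb K$ be a field. A braided algebra $(W,\sigma,m)$ is a vector space $W$ with linear maps $\sigma:W\otimes W\to W\otimes W$ and $m:W\otimes W\to W$ such that $\sigma_1\sigma_2\sigma_1=\sigma_2\sigma_1\sigma_2$ on $W^{\otimes 3}$, $m$ is associative, $\sigma(\mathrm{id}\otimes m)=(m\otimes \mathrm{id})\sigma_2\sigma_1$ and $\sigma(m\otimes\mathrm{id})=(\mathrm{id}\otimes m)\sigma_1\sigma_2$, where $\sigma_1=\sigma\otimes\mathrm{id}$, $\sigma_2=\mathrm{id}\otimes\sigma$. Let $(\widehat V,\sigma,m)$ be a braided algebra with an element $\mathbf 1\neq 0$ and a linear complement $V$ of $\mathbb K\mathbf 1$ such that $m(\mathbf 1\otimes v)=m(v\otimes\mathbf 1)=v$, $\sigma(\mathbf 1\otimes v)=v\otimes\mathbf 1$, $\sigma(v\otimes\mathbf 1)=\mathbf 1\otimes v$ for all $v\in\widehat V$, and such that $\sigma$ and $m$ restrict to $V$ (so $(V,\sigma,m)$ is a braided algebra). **Product.** The quantum quasi-shuffle product $\ast$ on $T(V)$ is the bilinear operation for which $1\in\mathbb K=V^{\otimes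 0}$ is a unit and, for $p,q\ge1$, $u=u_1\otimes u'\in V^{\otimes p}$ and $w=w_1\otimes w'\in V^{\otimes q}$ with $u_1,w_1\in V$, $$u\ast w=u_1\otimes(u'\ast w)+(\mathrm{id}\otimes\ast_{p,q-1})\big(\sigma_1\cdots\sigma_p(u\otimes w)\big)+(m\otimes\ast_{p-1,q-1})\big(\sigma_2\cdots\sigma_p(u\otimes w)\big),$$ where $\ast_{a,b}:V^{\otimes(a+b)}\to T(V)$ multiplies the first $a$ tensorands with the last $b$ ones and $\sigma_i$ is $\sigma$ acting on positions $i,i+1$. The deleting operator $\mathbf D:T(\widehat V)\to T(V)$ is the linear map that deletes all tensorands $\mathbf 1$ from pure tensors whose tensorands are $\mathbf 1$ or lie in $V$. **Monoid.** $\mathrm{GVB}_n^+$ is the monoid generated by $\sigma_i,\xi_i$ ($1\le i\le n-1$) with relations $\sigma_i\sigma_j=\sigma_j\sigma_i$, $\sigma_i\xi_j=\xi_j\sigma_i$, $\xi_i\xi_j=\xi_j\xi_i$ for $|i-j|>1$, and, for $1\le i\le n-2$, $\sigma_i\sigma_{i+1}\sigma_i=\sigma_{i+1}\sigma_i\sigma_{i+1}$,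 $\xi_i\xi_{i+1}\xi_i=\xi_{i+1}\xi_i\xi_{i+1}$, $\xi_i\sigma_{i+1}\sigma_i=\sigma_{i+1}\sigma_i\xi_{i+1}$, $\xi_{i+1}\sigma_i\sigma_{i+1}=\sigma_i\sigma_{i+1}\xi_i$. Let $l_v(\tau)$ be the number of letters $\xi_i$ in any expression of $\tau\in\mathrm{GVB}_n^+$. The algebra $\mathbb K[\mathrm{GVB}_n^+]$ acts on $\widehat V^{\otimes n}$: $\sigma_i$ acts as $\sigma$, and $\xi_i$ as $v\otimes w\mapsto\mathbf 1\otimes m(v\otimes w)$, on positions $i,i+1$. **Permutations.** Permutations in $\mathfrak S_n$ are composed as functions from right to left, and $s_i=(i,i+1)$. Put $\mathrm{des}_n(\sigma)=\{1\le i\le n-1:\sigma(i)>\sigma(i+1)\}$ and, for $I\subset\{1,\dots,n-1\}$, $\mathrm{des}_n(\le I)=\{\sigma\in\mathfrak S_n:\mathrm{des}_n(\sigma)\subset I\}$. For $a+p+q\le n$ let $\mathfrak S_{p,q}^{\uparrow a}\subset\mathfrak S_n$ be the set of permutations that are increasing on $\{a+1,\dots,a+p\}$ and on $\{a+p+1,\dots,a+p+q\}$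 and fix all other points; $\mathfrak S_{p,q}=\mathfrak S_{p,q}^{\uparrow 0}$. Every $\sigma\in\mathfrak S_n$ has a unique bubble decomposition $\sigma=\sigma^{(n-1)}\cdots\sigma^{(1)}$ in which either $\sigma^{(k)}=s_{t_k}s_{t_k+1}\cdots s_k$ with $1\le t_k\le k$, or $\sigma^{(k)}=e$ and $t_k=0$ (also $t_n=0$). **Lift.** For $\sigma\in\mathfrak S_n$ and $\tau\in\mathrm{GVB}^+_n$ with $l=l_v(\tau)$ put $$\mathbf M_{p,q}(\sigma,\tau)=\Big(\prod_{k=n-1,\dots,1;\ \sigma^{(k)}\ne e}\big(\sigma_{t_k}+(1-\delta_{t_k+1,t_{k+1}})\,\sigma_1\cdots\sigma_{t_k-1}\xi_{t_k}\big)\sigma_{t_k+1}\cdots\sigma_k\Big)\tau$$ (factors in descending order of $k$) if $p-l>0$ and $\sigma\in\mathfrak S_{p-l,q}^{\uparrow l}$, and $\mathbf M_{p,q}(\sigma,\tau)=0$ otherwise; extend linearly in $\tau$. Let $I=\{i_1<\dots<i_k\}\subset\{1,\dots,n-1\}$ with associated composition $(c_1,\dots,c_{k+1})=(i_1,i_2-i_1,\dots,n-i_k)$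 of $n$. Each $\sigma\in\mathrm{des}_n(\le I)$ is uniquely a product $\sigma=\sigma^k\cdots\sigma^2\sigma^1$ with $\sigma^l\in\mathfrak S_{c_1+\cdots+c_l,\,c_{l+1}}$, and $$Q_I(\sigma)=\mathbf M_{c_1+\cdots+c_k,c_{k+1}}\big(\sigma^k,\mathbf M_{c_1+\cdots+c_{k-1},c_k}(\sigma^{k-1},\cdots,\mathbf M_{c_1,c_2}(\sigma^1,e))\cdots\big)\in\mathbb K[\mathrm{GVB}_n^+]$$ (so $Q_\emptyset(e)=e$). **Theorem.** Let $n\ge 1$, $I\subset\{1,\dots,n-1\}$ and $(c_1,\dots,c_{k+1})$ be as above. For all $v_1,\dots,v_n\in V$, $$\Big(\cdots\big((v_1\otimes\cdots\otimes v_{c_1})\ast(v_{c_1+1}\otimes\cdots\otimes v_{c_1+c_2})\big)\ast\cdots\Big)\ast(v_{c_1+\cdots+c_k+1}\otimes\cdots\otimes v_n)=\mathbf D\Big(\sum_{\sigma\in\mathrm{des}_n(\le I)}Q_I(\sigma)(v_1\otimes\cdots\otimes v_n)\Big),$$ where $v_1\otimes\cdots\otimes v_n$ on the right is viewed in $\widehat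 V^{\otimes n}$. -/

import Mathlib

open scoped TensorProduct

/-! ## Operators on two tensor positions of `W^{⊗n}` -/

namespace TensorPos

variable {K W : Type*} [Field K] [AddCommGroup W] [Module K W] {n : ℕ}

/-- `a ⊗ b ↦ v₁ ⊗ ⋯ ⊗ vₙ` with the tensorands in positions `i ≠ j` replaced by `a` and `b`. -/
noncomputable def insertTwo (v : Fin n → W) (i j : Fin n) (h : i ≠ j) :
    W ⊗[K] W →ₗ[K] ⨂[K]^n W :=
  TensorProduct.lift (LinearMap.mk₂ K
    (fun a b => PiTensorProduct.tprod K (Function.update (Function.update v i a) j b))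
    (fun a a' b => by
      simp only [Function.update_comm h, MultilinearMap.map_update_add])
    (fun c a b => by
      simp only [Function.update_comm h, MultilinearMap.map_update_smul])
    (fun a b b' => by simp only [MultilinearMap.map_update_add])
    (fun c a b => by simp only [MultilinearMap.map_update_smul]))

theorem insertTwo_tmul (v : Fin n → W) (i j : Fin n) (h : i ≠ j) (a b : W) :
    insertTwo (K := K) v i j h (a ⊗ₜ b) =
      PiTensorProduct.tprod K (Function.update (Function.update v i a) j b) := by
  simp [insertTwo]

theorem insertTwo_update_left (v : Fin n → W) (i j : Fin n) (h : i ≠ j) (x : W) :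
    insertTwo (K := K) (Function.update v i x) i j h = insertTwo v i j h := by
  apply TensorProduct.ext'
  intro a b
  simp [insertTwo_tmul]

theorem insertTwo_update_right (v : Fin n → W) (i j : Fin n) (h : i ≠ j) (x : W) :
    insertTwo (K := K) (Function.update v j x) i j h = insertTwo v i j h := by
  apply TensorProduct.ext'
  intro a b
  simp [insertTwo_tmul, Function.update_comm h]

theorem insertTwo_update_add (v : Fin n → W) (i j k : Fin n) (h : i ≠ j) (hi : k ≠ i) (hj : k ≠ j)
    (x y : W) :
    insertTwo (K := K) (Function.update v k (x + y)) i j h =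
      insertTwo (Function.update v k x) i j h + insertTwo (Function.update v k y) i j h := by
  apply TensorProduct.ext'
  intro a b
  simp [insertTwo_tmul, Function.update_comm hi, Function.update_comm hj]

theorem insertTwo_update_smul (v : Fin n → W) (i j k : Fin n) (h : i ≠ j) (hi : k ≠ i) (hj : k ≠ j)
    (c : K) (x : W) :
    insertTwo (K := K) (Function.update v k (c • x)) i j h =
      c • insertTwo (Function.update v k x) i j h := by
  apply TensorProduct.ext'
  intro a b
  simp [insertTwo_tmul, Function.update_comm hi, Function.update_comm hj]

/-- The operator on `W^{⊗n}` that applies `f : W ⊗ W → W ⊗ W` to the tensorands in the positions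
`i` and `j`. For `j = i + 1` this is `id ⊗ ⋯ ⊗ f ⊗ ⋯ ⊗ id`. -/
noncomputable def actAt (f : W ⊗[K] W →ₗ[K] W ⊗[K] W) (i j : Fin n) (h : i ≠ j) :
    Module.End K (⨂[K]^n W) :=
  PiTensorProduct.lift
    { toFun := fun v => insertTwo v i j h (f (v i ⊗ₜ v j))
      map_update_add' := by
        intro inst v k x y
        obtain rfl : inst = instDecidableEqFin n := Subsingleton.elim _ _
        by_cases hi : k = i
        · subst hi
          simp [insertTwo_update_left, h.symm, TensorProduct.add_tmul]
        · by_cases hj : k = j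
          · subst hj
            simp [insertTwo_update_right, h, TensorProduct.tmul_add]
          · simp [insertTwo_update_add v i j k h hi hj, Ne.symm hi, Ne.symm hj]
      map_update_smul' := by
        intro inst v k c x
        obtain rfl : inst = instDecidableEqFin n := Subsingleton.elim _ _
        by_cases hi : k = i
        · subst hi
          simp [insertTwo_update_left, h.symm, ← TensorProduct.smul_tmul']
        · by_cases hj : k = j
          · subst hj
            simp [insertTwo_update_right, h]
          · simp [insertTwo_update_smul v i j k h hi hj, Ne.symm hi, Ne.symm hj] }

theorem actAt_tprod (f : W ⊗[K] W →ₗ[K] W ⊗[K] W) (i j : Fin n) (h : i ≠ j) (v : Fin n → W) :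
    actAt f i j h (PiTensorProduct.tprod K v) = insertTwo v i j h (f (v i ⊗ₜ v j)) := by
  simp [actAt]

/-- Replacing two disjoint pairs of tensorands. -/
noncomputable def insertFour (v : Fin n → W) (i j k l : Fin n) (hij : i ≠ j) (hkl : k ≠ l)
    (hik : i ≠ k) (hil : i ≠ l) (hjk : j ≠ k) (hjl : j ≠ l) :
    W ⊗[K] W →ₗ[K] W ⊗[K] W →ₗ[K] ⨂[K]^n W :=
  TensorProduct.lift (LinearMap.mk₂ K
    (fun a b => insertTwo (Function.update (Function.update v i a) j b) k l hkl)
    (fun a a' b => by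
      simp only [Function.update_comm hij, insertTwo_update_add _ k l i hkl hik hil])
    (fun c a b => by
      simp only [Function.update_comm hij, insertTwo_update_smul _ k l i hkl hik hil])
    (fun a b b' => by simp only [insertTwo_update_add _ k l j hkl hjk hjl])
    (fun c a b => by simp only [insertTwo_update_smul _ k l j hkl hjk hjl]))

theorem insertFour_tmul (v : Fin n → W) (i j k l : Fin n) (hij : i ≠ j) (hkl : k ≠ l)
    (hik : i ≠ k) (hil : i ≠ l) (hjk : j ≠ k) (hjl : j ≠ l) (a b : W) :
    insertFour (K := K) v i j k l hij hkl hik hil hjk hjl (a ⊗ₜ b) =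
      insertTwo (Function.update (Function.update v i a) j b) k l hkl := by
  simp [insertFour]

theorem insertFour_symm (v : Fin n → W) (i j k l : Fin n) (hij : i ≠ j) (hkl : k ≠ l)
    (hik : i ≠ k) (hil : i ≠ l) (hjk : j ≠ k) (hjl : j ≠ l) (x y : W ⊗[K] W) :
    insertFour (K := K) v i j k l hij hkl hik hil hjk hjl x y =
      insertFour v k l i j hkl hij hik.symm hjk.symm hil.symm hjl.symm y x := by
  have : insertFour (K := K) v i j k l hij hkl hik hil hjk hjl =
      (insertFour v k l i j hkl hij hik.symm hjk.symm hil.symm hjl.symm).flip := by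
    apply TensorProduct.ext'
    intro a b
    apply TensorProduct.ext'
    intro c d
    simp only [LinearMap.flip_apply, insertFour_tmul, insertTwo_tmul]
    rw [Function.update_comm hjk, Function.update_comm hik, Function.update_comm hjl,
      Function.update_comm hil]
  rw [this, LinearMap.flip_apply]

theorem actAt_insertTwo_far (f : W ⊗[K] W →ₗ[K] W ⊗[K] W) (v : Fin n → W) (i j k l : Fin n)
    (hij : i ≠ j) (hkl : k ≠ l) (hik : i ≠ k) (hil : i ≠ l) (hjk : j ≠ k) (hjl : j ≠ l)
    (z : W ⊗[K] W) :
    actAt f i j hij (insertTwo v k l hkl z) =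
      insertFour v k l i j hkl hij hik.symm hjk.symm hil.symm hjl.symm z (f (v i ⊗ₜ v j)) := by
  induction z with
  | zero => simp
  | add x y hx hy => simp [hx, hy]
  | tmul c d =>
    rw [insertTwo_tmul, actAt_tprod, insertFour_tmul]
    simp [hik, hil, hjk, hjl]

theorem actAt_comm (f g : W ⊗[K] W →ₗ[K] W ⊗[K] W) (i j k l : Fin n)
    (hij : i ≠ j) (hkl : k ≠ l) (hik : i ≠ k) (hil : i ≠ l) (hjk : j ≠ k) (hjl : j ≠ l) :
    actAt f i j hij * actAt g k l hkl = actAt g k l hkl * actAt f i j hij := by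
  apply PiTensorProduct.ext
  ext v
  simp only [LinearMap.compMultilinearMap_apply, Module.End.mul_apply, actAt_tprod]
  rw [actAt_insertTwo_far f v i j k l hij hkl hik hil hjk hjl,
    actAt_insertTwo_far g v k l i j hkl hij hik.symm hjk.symm hil.symm hjl.symm, insertFour_symm]

/-- `f` on the first two factors of `W ⊗ W ⊗ W`. -/
noncomputable def leg12 (f : W ⊗[K] W →ₗ[K] W ⊗[K] W) :
    W ⊗[K] (W ⊗[K] W) →ₗ[K] W ⊗[K] (W ⊗[K] W) :=
  (TensorProduct.assoc K W W W).toLinearMap ∘ₗ f.rTensor W ∘ₗ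
    (TensorProduct.assoc K W W W).symm.toLinearMap

/-- `f` on the last two factors of `W ⊗ W ⊗ W`. -/
noncomputable def leg23 (f : W ⊗[K] W →ₗ[K] W ⊗[K] W) :
    W ⊗[K] (W ⊗[K] W) →ₗ[K] W ⊗[K] (W ⊗[K] W) :=
  f.lTensor W

/-- Replacing three tensorands. -/
noncomputable def insertThree (v : Fin n → W) (i j k : Fin n) (hij : i ≠ j) (hik : i ≠ k)
    (hjk : j ≠ k) : W ⊗[K] (W ⊗[K] W) →ₗ[K] ⨂[K]^n W :=
  TensorProduct.lift
    { toFun := fun a => insertTwo (Function.update v i a) j k hjk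
      map_add' := fun a a' => insertTwo_update_add v j k i hjk hij hik a a'
      map_smul' := fun c a => insertTwo_update_smul v j k i hjk hij hik c a }

theorem insertThree_tmul (v : Fin n → W) (i j k : Fin n) (hij : i ≠ j) (hik : i ≠ k)
    (hjk : j ≠ k) (a : W) (z : W ⊗[K] W) :
    insertThree (K := K) v i j k hij hik hjk (a ⊗ₜ z) =
      insertTwo (Function.update v i a) j k hjk z := by
  simp [insertThree]

theorem insertThree_assoc (v : Fin n → W) (i j k : Fin n) (hij : i ≠ j) (hik : i ≠ k)
    (hjk : j ≠ k) (z : W ⊗[K] W) (c : W) :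
    insertThree (K := K) v i j k hij hik hjk (TensorProduct.assoc K W W W (z ⊗ₜ c)) =
      insertTwo (Function.update v k c) i j hij z := by
  induction z with
  | zero => simp
  | add x y hx hy => simp [TensorProduct.add_tmul, hx, hy]
  | tmul a b =>
    rw [TensorProduct.assoc_tmul, insertThree_tmul, insertTwo_tmul, insertTwo_tmul,
      Function.update_comm hjk, Function.update_comm hik]

theorem actAt_insertThree_12 (f : W ⊗[K] W →ₗ[K] W ⊗[K] W) (v : Fin n → W) (i j k : Fin n)
    (hij : i ≠ j) (hik : i ≠ k) (hjk : j ≠ k) (z : W ⊗[K] (W ⊗[K] W)) :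
    actAt f i j hij (insertThree v i j k hij hik hjk z) =
      insertThree v i j k hij hik hjk (leg12 f z) := by
  obtain ⟨z, rfl⟩ := (TensorProduct.assoc K W W W).surjective z
  induction z with
  | zero => simp
  | add x y hx hy => simp [hx, hy]
  | tmul z c =>
    have h1 : leg12 f (TensorProduct.assoc K W W W (z ⊗ₜ c)) =
        TensorProduct.assoc K W W W (f z ⊗ₜ c) := by simp [leg12]
    rw [h1, insertThree_assoc, insertThree_assoc]
    induction z with
    | zero => simp
    | add x y hx hy =>
      rw [map_add, map_add, map_add, map_add]
      rw [hx (by simp [leg12]), hy (by simp [leg12])]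
    | tmul a b =>
      rw [insertTwo_tmul, actAt_tprod, insertTwo_update_right, insertTwo_update_left]
      simp [hij]

theorem actAt_insertThree_23 (f : W ⊗[K] W →ₗ[K] W ⊗[K] W) (v : Fin n → W) (i j k : Fin n)
    (hij : i ≠ j) (hik : i ≠ k) (hjk : j ≠ k) (z : W ⊗[K] (W ⊗[K] W)) :
    actAt f j k hjk (insertThree v i j k hij hik hjk z) =
      insertThree v i j k hij hik hjk (leg23 f z) := by
  induction z with
  | zero => simp
  | add x y hx hy => simp [hx, hy]
  | tmul a z =>
    have h1 : leg23 f (a ⊗ₜ z) = a ⊗ₜ f z := by simp [leg23]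
    rw [h1, insertThree_tmul, insertThree_tmul]
    clear h1
    induction z with
    | zero => simp
    | add x y hx hy => simp only [map_add, hx, hy]
    | tmul b c =>
      rw [insertTwo_tmul, actAt_tprod, insertTwo_update_right, insertTwo_update_left]
      simp [hjk]

theorem tprod_eq_insertThree (v : Fin n → W) (i j k : Fin n)
    (hij : i ≠ j) (hik : i ≠ k) (hjk : j ≠ k) :
    PiTensorProduct.tprod K v =
      insertThree v i j k hij hik hjk (v i ⊗ₜ (v j ⊗ₜ v k)) := by
  rw [insertThree_tmul, insertTwo_tmul]
  simp

end TensorPos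

/-! ## Braided algebras -/

open TensorPos in
/-- `(W, σ, m)` is a braided algebra: `σ` satisfies the braid relation, `m` is associative and
`σ (id ⊗ m) = (m ⊗ id) σ₂ σ₁`, `σ (m ⊗ id) = (id ⊗ m) σ₁ σ₂`. -/
structure IsBraidedAlgebra {K W : Type*} [Field K] [AddCommGroup W] [Module K W]
    (σ : W ⊗[K] W →ₗ[K] W ⊗[K] W) (m : W ⊗[K] W →ₗ[K] W) : Prop where
  braid : leg12 σ ∘ₗ leg23 σ ∘ₗ leg12 σ = leg23 σ ∘ₗ leg12 σ ∘ₗ leg23 σ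
  assoc : m ∘ₗ m.rTensor W ∘ₗ (TensorProduct.assoc K W W W).symm.toLinearMap = m ∘ₗ m.lTensor W
  braid_lmul : σ ∘ₗ m.lTensor W =
    m.rTensor W ∘ₗ (TensorProduct.assoc K W W W).symm.toLinearMap ∘ₗ leg23 σ ∘ₗ leg12 σ
  braid_rmul : σ ∘ₗ m.rTensor W ∘ₗ (TensorProduct.assoc K W W W).symm.toLinearMap =
    m.lTensor W ∘ₗ leg12 σ ∘ₗ leg23 σ

/-- A braided algebra `(W, σ, m)` (the space written `V̂`) with a unit `1`, a linear complement `V`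
of `K·1`, and the restrictions of `σ` and `m` to `V`. These restrictions make `V` a braided
algebra; this is automatic, since `V ⊗ V ⊗ V → W ⊗ W ⊗ W` is injective. -/
structure AugmentedBraidedAlgebra (K W : Type*) [Field K] [AddCommGroup W] [Module K W] where
  σ : W ⊗[K] W →ₗ[K] W ⊗[K] W
  m : W ⊗[K] W →ₗ[K] W
  braided : IsBraidedAlgebra σ m
  one : W
  one_ne_zero : one ≠ 0
  one_mul : ∀ v, m (one ⊗ₜ v) = v
  mul_one : ∀ v, m (v ⊗ₜ one) = v
  braid_one_left : ∀ v, σ (one ⊗ₜ v) = v ⊗ₜ one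
  braid_one_right : ∀ v, σ (v ⊗ₜ one) = one ⊗ₜ v
  V : Submodule K W
  isCompl : IsCompl (K ∙ one) V
  σV : V ⊗[K] V →ₗ[K] V ⊗[K] V
  mV : V ⊗[K] V →ₗ[K] V
  σV_spec : ∀ x, TensorProduct.map V.subtype V.subtype (σV x) =
    σ (TensorProduct.map V.subtype V.subtype x)
  mV_spec : ∀ x, (mV x : W) = m (TensorProduct.map V.subtype V.subtype x)

/-! ## The generalized virtual braid monoid -/

/-- Generators `σ_i`, `ξ_i` for `1 ≤ i ≤ n - 1`. -/
inductive GVBGen (n : ℕ) : Type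
  | sigma (i : ℕ) (h : 1 ≤ i ∧ i < n) : GVBGen n
  | xi (i : ℕ) (h : 1 ≤ i ∧ i < n) : GVBGen n

/-- The defining relations of the generalized virtual braid monoid. -/
inductive GVBRel (n : ℕ) : FreeMonoid (GVBGen n) → FreeMonoid (GVBGen n) → Prop
  | sigma_sigma (i j : ℕ) (hi : 1 ≤ i ∧ i < n) (hj : 1 ≤ j ∧ j < n) (h : i + 1 < j ∨ j + 1 < i) :
      GVBRel n (.of (.sigma i hi) * .of (.sigma j hj)) (.of (.sigma j hj) * .of (.sigma i hi))
  | sigma_xi (i j : ℕ) (hi : 1 ≤ i ∧ i < n) (hj : 1 ≤ j ∧ j < n) (h : i + 1 < j ∨ j + 1 < i) :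
      GVBRel n (.of (.sigma i hi) * .of (.xi j hj)) (.of (.xi j hj) * .of (.sigma i hi))
  | xi_xi (i j : ℕ) (hi : 1 ≤ i ∧ i < n) (hj : 1 ≤ j ∧ j < n) (h : i + 1 < j ∨ j + 1 < i) :
      GVBRel n (.of (.xi i hi) * .of (.xi j hj)) (.of (.xi j hj) * .of (.xi i hi))
  | sigma_braid (i : ℕ) (hi : 1 ≤ i ∧ i < n) (hj : 1 ≤ i + 1 ∧ i + 1 < n) :
      GVBRel n (.of (.sigma i hi) * .of (.sigma (i + 1) hj) * .of (.sigma i hi))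
        (.of (.sigma (i + 1) hj) * .of (.sigma i hi) * .of (.sigma (i + 1) hj))
  | xi_braid (i : ℕ) (hi : 1 ≤ i ∧ i < n) (hj : 1 ≤ i + 1 ∧ i + 1 < n) :
      GVBRel n (.of (.xi i hi) * .of (.xi (i + 1) hj) * .of (.xi i hi))
        (.of (.xi (i + 1) hj) * .of (.xi i hi) * .of (.xi (i + 1) hj))
  | mixed_left (i : ℕ) (hi : 1 ≤ i ∧ i < n) (hj : 1 ≤ i + 1 ∧ i + 1 < n) :
      GVBRel n (.of (.xi i hi) * .of (.sigma (i + 1) hj) * .of (.sigma i hi))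
        (.of (.sigma (i + 1) hj) * .of (.sigma i hi) * .of (.xi (i + 1) hj))
  | mixed_right (i : ℕ) (hi : 1 ≤ i ∧ i < n) (hj : 1 ≤ i + 1 ∧ i + 1 < n) :
      GVBRel n (.of (.xi (i + 1) hj) * .of (.sigma i hi) * .of (.sigma (i + 1) hj))
        (.of (.sigma i hi) * .of (.sigma (i + 1) hj) * .of (.xi i hi))

/-- The generalized virtual braid monoid `GVB_n⁺`. -/
abbrev GVB (n : ℕ) : Type := PresentedMonoid (GVBRel n)

namespace GVB

/-- The generator `σ_i` (and `1` if `i` is not in `{1, …, n-1}`). -/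
def sig (n i : ℕ) : GVB n :=
  if h : 1 ≤ i ∧ i < n then PresentedMonoid.of (GVBRel n) (.sigma i h) else 1

/-- The generator `ξ_i` (and `1` if `i` is not in `{1, …, n-1}`). -/
def xi (n i : ℕ) : GVB n :=
  if h : 1 ≤ i ∧ i < n then PresentedMonoid.of (GVBRel n) (.xi i h) else 1

/-- The virtual length as a monoid homomorphism: `σ_i ↦ 0`, `ξ_i ↦ 1`. -/
def virtualLengthHom (n : ℕ) : GVB n →* Multiplicative ℕ :=
  PresentedMonoid.lift
    (fun g => match g with
      | .sigma _ _ => Multiplicative.ofAdd 0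
      | .xi _ _ => Multiplicative.ofAdd 1)
    (by rintro a b (_ | _ | _ | _ | _ | _ | _) <;> simp)

/-- The number `l_v(τ)` of letters `ξ_i` in any expression of `τ`. -/
def virtualLength {n : ℕ} (τ : GVB n) : ℕ := Multiplicative.toAdd (virtualLengthHom n τ)

end GVB

/-! ## The representation of `GVB_n⁺` and the deleting operator -/

namespace AugmentedBraidedAlgebra

open TensorPos

variable {K W : Type*} [Field K] [AddCommGroup W] [Module K W] (A : AugmentedBraidedAlgebra K W)

/-- `σ^m (v ⊗ w) = 1 ⊗ m (v ⊗ w)`. -/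
noncomputable def σm : W ⊗[K] W →ₗ[K] W ⊗[K] W := TensorProduct.mk K W W A.one ∘ₗ A.m

/-- The operator `id^{⊗(i-1)} ⊗ f ⊗ id^{⊗(n-i-1)}` on `W^{⊗n}`. -/
noncomputable def local₂ {W : Type*} [AddCommGroup W] [Module K W] {n : ℕ}
    (f : W ⊗[K] W →ₗ[K] W ⊗[K] W) (i : ℕ) (h : 1 ≤ i ∧ i < n) : Module.End K (⨂[K]^n W) :=
  actAt f ⟨i - 1, by omega⟩ ⟨i, h.2⟩ (by simp only [ne_eq, Fin.mk.injEq]; omega)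

theorem local₂_comm {n : ℕ} (f g : W ⊗[K] W →ₗ[K] W ⊗[K] W) (i j : ℕ) (hi : 1 ≤ i ∧ i < n)
    (hj : 1 ≤ j ∧ j < n) (h : i + 1 < j ∨ j + 1 < i) :
    local₂ f i hi * local₂ g j hj = local₂ g j hj * local₂ f i hi := by
  apply actAt_comm <;> simp only [ne_eq, Fin.mk.injEq] <;> omega

theorem local₂_triple {n : ℕ} (f g h f' g' h' : W ⊗[K] W →ₗ[K] W ⊗[K] W) (i : ℕ)
    (hi : 1 ≤ i ∧ i < n) (hj : 1 ≤ i + 1 ∧ i + 1 < n)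
    (H : leg12 f ∘ₗ leg23 g ∘ₗ leg12 h = leg23 f' ∘ₗ leg12 g' ∘ₗ leg23 h') :
    local₂ f i hi * local₂ g (i + 1) hj * local₂ h i hi =
      local₂ f' (i + 1) hj * local₂ g' i hi * local₂ h' (i + 1) hj := by
  apply PiTensorProduct.ext
  ext v
  have h12 : (⟨i - 1, by omega⟩ : Fin n) ≠ ⟨i, hi.2⟩ := by
    simp only [ne_eq, Fin.mk.injEq]; omega
  have h13 : (⟨i - 1, by omega⟩ : Fin n) ≠ ⟨i + 1, hj.2⟩ := by
    simp only [ne_eq, Fin.mk.injEq]; omega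
  have h23 : (⟨i, hi.2⟩ : Fin n) ≠ ⟨i + 1, hj.2⟩ := by
    simp only [ne_eq, Fin.mk.injEq]; omega
  have e1 : ∀ (u : W ⊗[K] W →ₗ[K] W ⊗[K] W), local₂ u i hi = actAt u _ _ h12 := fun _ => rfl
  have e2 : ∀ (u : W ⊗[K] W →ₗ[K] W ⊗[K] W), local₂ u (i + 1) hj = actAt u _ _ h23 :=
    fun _ => rfl
  simp only [LinearMap.compMultilinearMap_apply, Module.End.mul_apply, e1, e2]
  rw [tprod_eq_insertThree v _ _ _ h12 h13 h23]
  simp only [actAt_insertThree_12, actAt_insertThree_23]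
  exact congrArg _ (LinearMap.congr_fun H _)

theorem xi_braid_three :
    leg12 A.σm ∘ₗ leg23 A.σm ∘ₗ leg12 A.σm = leg23 A.σm ∘ₗ leg12 A.σm ∘ₗ leg23 A.σm := by
  apply TensorProduct.ext_threefold'
  intro a b c
  have h := LinearMap.congr_fun A.braided.assoc (a ⊗ₜ (b ⊗ₜ c))
  simp only [LinearMap.comp_apply, LinearEquiv.coe_coe, TensorProduct.assoc_symm_tmul,
    LinearMap.rTensor_tmul, LinearMap.lTensor_tmul] at h
  simp [leg12, leg23, σm, A.one_mul, A.mul_one, h]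

theorem mixed_left_three :
    leg12 A.σm ∘ₗ leg23 A.σ ∘ₗ leg12 A.σ = leg23 A.σ ∘ₗ leg12 A.σ ∘ₗ leg23 A.σm := by
  apply TensorProduct.ext_threefold'
  intro a b c
  have h := LinearMap.congr_fun A.braided.braid_lmul (a ⊗ₜ (b ⊗ₜ c))
  have h1 : ∀ z : W ⊗[K] (W ⊗[K] W), leg12 A.σm z =
      A.one ⊗ₜ (A.m.rTensor W ((TensorProduct.assoc K W W W).symm z)) := by
    intro z
    obtain ⟨z, rfl⟩ := (TensorProduct.assoc K W W W).surjective z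
    induction z with
    | zero => simp
    | add x y hx hy => simp only [map_add, hx, hy, TensorProduct.tmul_add]
    | tmul z c => simp [leg12, σm]
  have h2 : leg12 A.σ (leg23 A.σm (a ⊗ₜ (b ⊗ₜ c))) = A.one ⊗ₜ (a ⊗ₜ A.m (b ⊗ₜ c)) := by
    simp [leg12, leg23, σm, A.braid_one_right]
  simp only [LinearMap.comp_apply, LinearEquiv.coe_coe, LinearMap.lTensor_tmul] at h ⊢
  rw [h1, ← h, h2]
  simp [leg23]

theorem mixed_right_three :
    leg12 A.σ ∘ₗ leg23 A.σ ∘ₗ leg12 A.σm = leg23 A.σm ∘ₗ leg12 A.σ ∘ₗ leg23 A.σ := by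
  apply TensorProduct.ext_threefold'
  intro a b c
  have h := LinearMap.congr_fun A.braided.braid_rmul (a ⊗ₜ (b ⊗ₜ c))
  simp only [LinearMap.comp_apply, LinearEquiv.coe_coe, TensorProduct.assoc_symm_tmul,
    LinearMap.rTensor_tmul] at h ⊢
  have h1 : ∀ z : W ⊗[K] (W ⊗[K] W), leg23 A.σm z =
      (TensorProduct.mk K W W A.one).lTensor W (A.m.lTensor W z) := by
    intro z
    rw [← LinearMap.comp_apply, ← LinearMap.lTensor_comp]
    rfl
  have h2 : ∀ z : W ⊗[K] W, leg12 A.σ (A.one ⊗ₜ z) =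
      (TensorProduct.mk K W W A.one).lTensor W z := by
    intro z
    induction z with
    | zero => simp
    | add x y hx hy => simp only [map_add, hx, hy, TensorProduct.tmul_add]
    | tmul x y => simp [leg12, A.braid_one_left]
  rw [h1, ← h, ← h2]
  simp [leg12, leg23, σm]

/-- The representation of `GVB_n⁺` on `W^{⊗n}`: `σ_i` acts by `σ` and `ξ_i` by `σ^m` on the
positions `i, i + 1`. -/
noncomputable def rep (n : ℕ) : GVB n →* Module.End K (⨂[K]^n W) :=
  PresentedMonoid.lift
    (fun g => match g with
      | .sigma i h => local₂ A.σ i h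
      | .xi i h => local₂ A.σm i h)
    (by
      rintro a b (⟨i, j, hi, hj, h⟩ | ⟨i, j, hi, hj, h⟩ | ⟨i, j, hi, hj, h⟩ | ⟨i, hi, hj⟩ |
        ⟨i, hi, hj⟩ | ⟨i, hi, hj⟩ | ⟨i, hi, hj⟩)
      all_goals simp only [map_mul, FreeMonoid.lift_eval_of]
      · exact local₂_comm _ _ i j hi hj h
      · exact local₂_comm _ _ i j hi hj h
      · exact local₂_comm _ _ i j hi hj h
      · exact local₂_triple _ _ _ _ _ _ i hi hj A.braided.braid
      · exact local₂_triple _ _ _ _ _ _ i hi hj A.xi_braid_three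
      · exact local₂_triple _ _ _ _ _ _ i hi hj A.mixed_left_three
      · exact (local₂_triple _ _ _ _ _ _ i hi hj A.mixed_right_three).symm)

/-- The action of the algebra `K[GVB_n⁺]` on `W^{⊗n}`. -/
noncomputable def algRep (n : ℕ) : MonoidAlgebra K (GVB n) →ₐ[K] Module.End K (⨂[K]^n W) :=
  MonoidAlgebra.lift K (Module.End K (⨂[K]^n W)) (GVB n) (A.rep n)

/-- The linear map `W = K·1 ⊕ V → T(V)` with `c·1 + v ↦ c + v`. -/
noncomputable def deleteOne : W →ₗ[K] TensorAlgebra K A.V :=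
  Algebra.linearMap K (TensorAlgebra K A.V) ∘ₗ
      (LinearEquiv.toSpanNonzeroSingleton K W A.one A.one_ne_zero).symm.toLinearMap ∘ₗ
      (K ∙ A.one).projectionOnto A.V A.isCompl +
    TensorAlgebra.ι K ∘ₗ A.V.projectionOnto (K ∙ A.one) A.isCompl.symm

/-- The deleting operator `D : T(W) → T(V)`. It is multiplicative for the tensor product, sends the
tensorand `1` to the empty tensor and fixes the tensorands in `V` (see the two lemmas below). -/
noncomputable def delete : TensorAlgebra K W →ₗ[K] TensorAlgebra K A.V :=
  (TensorAlgebra.lift K A.deleteOne).toLinearMap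

theorem deleteOne_one : A.deleteOne A.one = 1 := by
  have h1 := Submodule.projectionOnto_apply_left A.isCompl
    ⟨A.one, Submodule.mem_span_singleton_self A.one⟩
  have h2 := Submodule.projectionOnto_apply_right A.isCompl.symm
    ⟨A.one, Submodule.mem_span_singleton_self A.one⟩
  simp only at h1 h2
  have h3 : (LinearEquiv.toSpanNonzeroSingleton K W A.one A.one_ne_zero).symm
      ⟨A.one, Submodule.mem_span_singleton_self A.one⟩ = 1 := by
    rw [LinearEquiv.symm_apply_eq]
    ext
    simp
  simp [deleteOne, h1, h2, h3]

theorem deleteOne_coe (v : A.V) : A.deleteOne v = TensorAlgebra.ι K v := by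
  simp [deleteOne]

end AugmentedBraidedAlgebra

/-! ## The quantum quasi-shuffle product -/

namespace QuasiShuffle

open AugmentedBraidedAlgebra

variable {K V : Type*} [Field K] [AddCommGroup V] [Module K V]

/-- The linear map on `V^{⊗(N+1)}` given by `v₀ ⊗ x ↦ F v₀ x`, for `x ∈ V^{⊗N}`. -/
noncomputable def headTail {N : ℕ} {M : Type*} [AddCommGroup M] [Module K M]
    (F : V →ₗ[K] (⨂[K]^N V) →ₗ[K] M) : (⨂[K]^(N + 1) V) →ₗ[K] M :=
  PiTensorProduct.lift (LinearMap.uncurryLeft (M := fun _ : Fin (N + 1) => V)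
    ((PiTensorProduct.lift (R := K) (s := fun _ : Fin N => V) (E := M)).symm.toLinearMap ∘ₗ F))

/-- `v₀ ⊗ x ↦ v₀ ⊗ g x`. -/
noncomputable def consMap {N : ℕ} (g : (⨂[K]^N V) →ₗ[K] TensorAlgebra K V) :
    (⨂[K]^(N + 1) V) →ₗ[K] TensorAlgebra K V :=
  headTail (((LinearMap.mul K (TensorAlgebra K V)) ∘ₗ TensorAlgebra.ι K).compl₂ g)

/-- `v₀ ⊗ v₁ ⊗ x ↦ m (v₀ ⊗ v₁) ⊗ g x`. -/
noncomputable def consMulMap {N : ℕ} (m : V ⊗[K] V →ₗ[K] V)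
    (g : (⨂[K]^N V) →ₗ[K] TensorAlgebra K V) : (⨂[K]^(N + 2) V) →ₗ[K] TensorAlgebra K V :=
  headTail
    { toFun := fun v₀ => headTail
        (((LinearMap.mul K (TensorAlgebra K V)) ∘ₗ TensorAlgebra.ι K ∘ₗ m ∘ₗ
          TensorProduct.mk K V V v₀).compl₂ g)
      map_add' := by
        intro a b
        apply PiTensorProduct.ext
        ext v
        simp [headTail]
      map_smul' := by
        intro c a
        apply PiTensorProduct.ext
        ext v
        simp [headTail] }

/-- The operator `σ_a σ_{a+1} ⋯ σ_b` on `V^{⊗n}` (the identity if `b < a`); indices outside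
`{1, …, n-1}` are skipped. -/
noncomputable def braidRun (σ : V ⊗[K] V →ₗ[K] V ⊗[K] V) (n a b : ℕ) :
    Module.End K (⨂[K]^n V) :=
  ((List.range' a (b + 1 - a)).map
    (fun i => if h : 1 ≤ i ∧ i < n then local₂ σ i h else 1)).prod

/-- The quantum quasi-shuffle product of the first `p` tensorands of an element of `V^{⊗N}` with the
remaining `N - p` ones: for `u = u₁ ⊗ u'` of degree `p ≥ 1` and `w = w₁ ⊗ w'` of degree
`q = N - p ≥ 1`,
`u ∗ w = u₁ ⊗ (u' ∗ w) + (id ⊗ ∗) (β_{p,1} (u ⊗ w₁) ⊗ w') + (m ⊗ ∗) (u₁ ⊗ β_{p-1,1} (u' ⊗ w₁) ⊗ w')`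
where `β_{p,1} = σ₁ ⋯ σ_p` moves `w₁` to the left over `p` tensorands. -/
noncomputable def prodAux (σ : V ⊗[K] V →ₗ[K] V ⊗[K] V) (m : V ⊗[K] V →ₗ[K] V) :
    (N p : ℕ) → (⨂[K]^N V) →ₗ[K] TensorAlgebra K V
  | 0, _ => TensorPower.toTensorAlgebra
  | 1, _ => TensorPower.toTensorAlgebra
  | _ + 2, 0 => TensorPower.toTensorAlgebra
  | N + 2, p + 1 =>
    if N + 2 ≤ p + 1 then TensorPower.toTensorAlgebra
    else
      consMap (prodAux σ m (N + 1) p) +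
      consMap (prodAux σ m (N + 1) (p + 1)) ∘ₗ braidRun σ (N + 2) 1 (p + 1) +
      consMulMap m (prodAux σ m N p) ∘ₗ braidRun σ (N + 2) 2 (p + 1)

/-- The product `V^{⊗p} × V^{⊗q} → T(V)`. -/
noncomputable def prodHomog (σ : V ⊗[K] V →ₗ[K] V ⊗[K] V) (m : V ⊗[K] V →ₗ[K] V) (p q : ℕ) :
    (⨂[K]^p V) →ₗ[K] (⨂[K]^q V) →ₗ[K] TensorAlgebra K V :=
  TensorProduct.curry (prodAux σ m (p + q) p ∘ₗ TensorPower.mulEquiv.toLinearMap)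

/-- The quantum quasi-shuffle product on `T(V)`. -/
noncomputable def qqsMul (σ : V ⊗[K] V →ₗ[K] V ⊗[K] V) (m : V ⊗[K] V →ₗ[K] V) :
    TensorAlgebra K V →ₗ[K] TensorAlgebra K V →ₗ[K] TensorAlgebra K V :=
  (DirectSum.toModule K ℕ ((DirectSum ℕ fun q => ⨂[K]^q V) →ₗ[K] TensorAlgebra K V) fun p =>
    (DirectSum.toModule K ℕ ((⨂[K]^p V) →ₗ[K] TensorAlgebra K V) fun q =>
      (prodHomog σ m p q).flip).flip).compl₁₂
    TensorAlgebra.toDirectSum.toLinearMap TensorAlgebra.toDirectSum.toLinearMap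

/-- `(⋯((x₁ ∗ x₂) ∗ x₃)∗ ⋯) ∗ x_r` (and `1` for the empty list). -/
noncomputable def leftStar (σ : V ⊗[K] V →ₗ[K] V ⊗[K] V) (m : V ⊗[K] V →ₗ[K] V) :
    List (TensorAlgebra K V) → TensorAlgebra K V
  | [] => 1
  | x :: xs => xs.foldl (fun y z => qqsMul σ m y z) x

/-- The left-iterated quantum quasi-shuffle product of the consecutive blocks of
`v₁ ⊗ ⋯ ⊗ vₙ` of sizes given by the composition `c`. -/
noncomputable def blockProduct (σ : V ⊗[K] V →ₗ[K] V ⊗[K] V) (m : V ⊗[K] V →ₗ[K] V) {n : ℕ}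
    (c : Composition n) (v : Fin n → V) : TensorAlgebra K V :=
  leftStar σ m (List.ofFn fun l : Fin c.length =>
    TensorAlgebra.tprod K V (c.blocksFun l) (v ∘ c.embedding l))

end QuasiShuffle

/-! ## Permutations, shuffles and descents

Positions are `1, …, n` in the indices of `s_i`, `σ_i`, `ξ_i`; position `i` is the element `i - 1`
of `Fin n`. Permutations are composed as functions, `(σ τ)(i) = σ (τ i)`, so that in the place
action `σ i` is the position to which the `i`-th tensorand is moved. With the opposite convention
(products composed from left to right) the same word in the `s_i` is the inverse function, and the
conditions below read `σ⁻¹(1) < ⋯ < σ⁻¹(p)` and `σ⁻¹(i) > σ⁻¹(i + 1)`. -/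

namespace GenMatsumotoTits

/-- The transposition `s_i = (i, i + 1)` (and `1` if `i` is not in `{1, …, n-1}`). -/
def s (n i : ℕ) : Equiv.Perm (Fin n) :=
  if h : 1 ≤ i ∧ i < n then Equiv.swap ⟨i - 1, by omega⟩ ⟨i, h.2⟩ else 1

/-- `g_a g_{a+1} ⋯ g_b` (and `1` if `b < a`). -/
def ascProd {M : Type*} [Monoid M] (g : ℕ → M) (a b : ℕ) : M :=
  ((List.range' a (b + 1 - a)).map g).prod

/-- `g_{n-1} g_{n-2} ⋯ g_1`. -/
def descProd {M : Type*} [Monoid M] (g : ℕ → M) (n : ℕ) : M :=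
  ((List.range' 1 (n - 1)).reverse.map g).prod

/-- `σ ∈ 𝔖_{p,q}^{↑a} ⊂ 𝔖_n`: `σ` is a `(p,q)`-shuffle of the positions `a + 1, …, a + p + q` and
fixes all other positions. -/
def IsShuffle {n : ℕ} (a p q : ℕ) (σ : Equiv.Perm (Fin n)) : Prop :=
  (∀ i : Fin n, (i : ℕ) < a ∨ a + p + q ≤ i → σ i = i) ∧
  (∀ i j : Fin n, a ≤ i → i < j → (j : ℕ) < a + p → σ i < σ j) ∧
  (∀ i j : Fin n, a + p ≤ i → i < j → (j : ℕ) < a + p + q → σ i < σ j)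

/-- The sequence `t` encodes the bubble decomposition `σ = σ^{(n-1)} ⋯ σ^{(1)}`, where
`σ^{(k)} = s_{t_k} s_{t_k + 1} ⋯ s_k` if `1 ≤ t_k ≤ k` and `σ^{(k)} = e` if `t_k = 0`. -/
def IsBubble {n : ℕ} (σ : Equiv.Perm (Fin n)) (t : ℕ → ℕ) : Prop :=
  (∀ k, t k ≤ k) ∧ (∀ k, n ≤ k → t k = 0) ∧
  σ = descProd (fun k => if t k = 0 then 1 else ascProd (s n) (t k) k) n

open Classical in
/-- The indices `t_k(σ)` of the (unique) bubble decomposition. -/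
noncomputable def bubble {n : ℕ} (σ : Equiv.Perm (Fin n)) : ℕ → ℕ :=
  if h : ∃ t, IsBubble σ t then h.choose else fun _ => 0

variable (K : Type*) [Field K]

/-- `σ_i` in `K[GVB_n⁺]`. -/
noncomputable def sigA (n i : ℕ) : MonoidAlgebra K (GVB n) := MonoidAlgebra.of K _ (GVB.sig n i)

/-- `ξ_i` in `K[GVB_n⁺]`. -/
noncomputable def xiA (n i : ℕ) : MonoidAlgebra K (GVB n) := MonoidAlgebra.of K _ (GVB.xi n i)

/-- The lift
`∏_{k = n-1, …, 1; t_k ≠ 0} (σ_{t_k} + (1 - δ_{t_k + 1, t_{k+1}}) σ_1 ⋯ σ_{t_k - 1} ξ_{t_k})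
σ_{t_k + 1} ⋯ σ_k` of a permutation. -/
noncomputable def bubbleLift {n : ℕ} (σ : Equiv.Perm (Fin n)) : MonoidAlgebra K (GVB n) :=
  descProd (fun k =>
    if bubble σ k = 0 then 1
    else
      (sigA K n (bubble σ k) +
        (if bubble σ k + 1 = bubble σ (k + 1) then 0
          else ascProd (sigA K n) 1 (bubble σ k - 1) * xiA K n (bubble σ k))) *
      ascProd (sigA K n) (bubble σ k + 1) k) n

open Classical in
/-- `Q_{p,q}^{→a}`, the generalized Matsumoto–Tits section for `(p,q)`-shuffles of the positions
`a + 1, …, a + p + q`, extended by zero to `𝔖_n`. -/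
noncomputable def Qshuffle {n : ℕ} (a p q : ℕ) (σ : Equiv.Perm (Fin n)) :
    MonoidAlgebra K (GVB n) :=
  if IsShuffle a p q σ then bubbleLift K σ else 0

/-- `M_{p,q}(σ, τ)` for `τ ∈ GVB_n⁺`. -/
noncomputable def Mbasis {n : ℕ} (p q : ℕ) (σ : Equiv.Perm (Fin n)) (τ : GVB n) :
    MonoidAlgebra K (GVB n) :=
  if GVB.virtualLength τ < p then
    Qshuffle K (GVB.virtualLength τ) (p - GVB.virtualLength τ) q σ * MonoidAlgebra.of K _ τ
  else 0

/-- `M_{p,q}(σ, x)`, linear in `x ∈ K[GVB_n⁺]`. -/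
noncomputable def M {n : ℕ} (p q : ℕ) (σ : Equiv.Perm (Fin n)) (x : MonoidAlgebra K (GVB n)) :
    MonoidAlgebra K (GVB n) :=
  x.coeff.sum fun τ a => a • Mbasis K p q σ τ

/-- The composition `c = (i₁, i₂ - i₁, …, i_k - i_{k-1}, n - i_k)` of `n` associated with
`I = {i₁ < ⋯ < i_k} ⊂ {1, …, n-1}`. The element `i` of `Fin (n - 1)` stands for `i + 1`. -/
def compositionOf {n : ℕ} (I : Finset (Fin (n - 1))) : Composition n :=
  (compositionEquiv n).symm ((compositionAsSetEquiv n).symm I)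

/-- The descent set of `σ`; the element `i` of `Fin (n - 1)` stands for the position `i + 1`. -/
def descents {n : ℕ} (σ : Equiv.Perm (Fin n)) : Finset (Fin (n - 1)) :=
  Finset.univ.filter fun i => σ ⟨i + 1, by omega⟩ < σ ⟨i, by omega⟩

/-- `des_n(≤ I)`. -/
def desLE {n : ℕ} (I : Finset (Fin (n - 1))) : Finset (Equiv.Perm (Fin n)) :=
  Finset.univ.filter fun σ => descents σ ⊆ I

/-- The size `c_1 + ⋯ + c_{l+1}`, for `l = 0, …, k - 1`. -/
def leftSize {n : ℕ} (c : Composition n) (l : Fin (c.length - 1)) : ℕ := c.sizeUpTo (l + 1)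

/-- The size `c_{l+2}`, for `l = 0, …, k - 1`. -/
def rightSize {n : ℕ} (c : Composition n) (l : Fin (c.length - 1)) : ℕ :=
  c.blocksFun ⟨l + 1, by omega⟩

/-- `(w (k-1), …, w 0)` is the decomposition of `σ` in
`𝔖_{c_1 + ⋯ + c_k, c_{k+1}} × ⋯ × 𝔖_{c_1 + c_2, c_3} × 𝔖_{c_1, c_2}`:
`σ = w (k-1) ⋯ w 1 · w 0`. -/
def IsShuffleDecomp {n : ℕ} (c : Composition n) (σ : Equiv.Perm (Fin n))
    (w : Fin (c.length - 1) → Equiv.Perm (Fin n)) : Prop :=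
  (∀ l, IsShuffle 0 (leftSize c l) (rightSize c l) (w l)) ∧ (List.ofFn w).reverse.prod = σ

/-- `M_{c_1 + ⋯ + c_k, c_{k+1}}(w (k-1), ⋯ M_{c_1 + c_2, c_3}(w 1, M_{c_1, c_2}(w 0, e)) ⋯)`. -/
noncomputable def iteratedM {n : ℕ} (c : Composition n)
    (w : Fin (c.length - 1) → Equiv.Perm (Fin n)) : MonoidAlgebra K (GVB n) :=
  (List.finRange (c.length - 1)).foldl
    (fun x l => M K (leftSize c l) (rightSize c l) (w l) x) 1

open Classical in
/-- The lift `Q_I : des_n(≤ I) → K[GVB_n⁺]`, through the (unique) shuffle decomposition. -/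
noncomputable def QI {n : ℕ} (I : Finset (Fin (n - 1))) (σ : Equiv.Perm (Fin n)) :
    MonoidAlgebra K (GVB n) :=
  if h : ∃ w, IsShuffleDecomp (compositionOf I) σ w then iteratedM K (compositionOf I) h.choose
  else 0

end GenMatsumotoTits

/-! The sum of the lifts of all shuffles satisfies the same three-term recursion as the quantum
quasi-shuffle product, and the two recursions correspond under the action on tensors with leading
units.

Combinatorial side. A shuffle in 𝔖_{p+1,q+1}^{↑a} either fixes the position a+1, and then lies in
𝔖_{p,q+1}^{↑a+1}, or brings the first position a+p+2 of the second block to a+1. In the second case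
it is σ' s_{a+1} ⋯ s_{a+p+1} with a unique σ' in 𝔖_{p+1,q}^{↑a+1}, and its bubble decomposition is
that of σ' with one more factor on the right, of index k = a+p+1 and t_k = a+1. The lift of this
factor has a σ part and a ξ part. The Kronecker delta kills the ξ part exactly when t_{k+1} = a+2,
that is, when σ' does not fix a+2; the ξ parts that remain are therefore indexed by 𝔖_{p,q}^{↑a+2}.
This is `shuffleSum_succ_succ`.

Algebraic side. On 1^{⊗l} ⊗ z ⊗ (untouched tensorands of v), a run of σ's at positions beyond l acts
on z by the braiding of V. The word σ_1 ⋯ σ_{l+b} ξ_{l+b+1} multiplies two neighbours of z and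
carries the unit thus created to the front (`rep_xi_pad`), so the form is kept with l+1 in place of
l. With a = l+b, where b counts the tensorands of z already in final place, the three terms of the
recursion become the three terms of the product (`prefixProd_succ_right`). Induction gives
`shuffleSum_mem_tracked`.

Iteration. A permutation with descents in I factors uniquely into shuffles of growing initial
segments, so the sum of all Q_I(σ) is an iteration of the operators ∑ M_{p,q}(σ, ·) (`sum_QI`). Such
an operator acts on a monoid element τ through l_v(τ), the number of leading units that τ has
produced. Hence the invariant `tracked` records monoid elements one by one, each paired with the
tensor z that it yields. Every step preserves the invariant, and at the end deleting the units
leaves the product. -/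

namespace GenMatsumotoTits

/-! ## Ascending and descending products -/

section Products

variable {M : Type*} [Monoid M]

theorem ascProd_of_lt (g : ℕ → M) {a b : ℕ} (h : b < a) : ascProd g a b = 1 := by
  have : b + 1 - a = 0 := by omega
  simp [ascProd, this]

theorem ascProd_eq_mul (g : ℕ → M) {a b : ℕ} (h : a ≤ b) :
    ascProd g a b = g a * ascProd g (a + 1) b := by
  obtain ⟨d, rfl⟩ := Nat.exists_eq_add_of_le h
  have h1 : a + d + 1 - a = d + 1 := by omega
  have h2 : a + d + 1 - (a + 1) = d := by omega
  simp [ascProd, h1, h2, List.range'_succ]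

theorem map_ascProd {N : Type*} [Monoid N] (f : M →* N) (g : ℕ → M) (a b : ℕ) :
    f (ascProd g a b) = ascProd (fun i => f (g i)) a b := by
  simp [ascProd, map_list_prod, Function.comp_def]

theorem descProd_zero (g : ℕ → M) : descProd g 0 = 1 := by simp [descProd]

theorem descProd_one (g : ℕ → M) : descProd g 1 = 1 := by simp [descProd]

theorem descProd_add_two (g : ℕ → M) (k : ℕ) :
    descProd g (k + 2) = g (k + 1) * descProd g (k + 1) := by
  simp [descProd, List.range'_concat, add_comm 1 k]

theorem descProd_eq_one {g : ℕ → M} {n : ℕ} (h : ∀ k, 1 ≤ k → k < n → g k = 1) :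
    descProd g n = 1 := by
  induction n with
  | zero => exact descProd_zero g
  | succ n ih =>
    cases n with
    | zero => exact descProd_one g
    | succ n =>
      rw [descProd_add_two, h _ (by omega) (by omega), one_mul]
      exact ih fun k h1 h2 => h k h1 (by omega)

/-- Both a bubble decomposition and its lift grow in this way: as long as the slots up to `j` are
empty, filling slot `j` multiplies the product by one factor on the right. -/
theorem descProd_eq_mul {g h : ℕ → M} {j n : ℕ} (hj : 1 ≤ j) (hjn : j < n)
    (hg : ∀ k, 1 ≤ k → k ≤ j → g k = 1) (hh : ∀ k, 1 ≤ k → k < j → h k = 1)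
    (hgh : ∀ k, j < k → h k = g k) : descProd h n = descProd g n * h j := by
  induction n with
  | zero => omega
  | succ n ih =>
    obtain ⟨n, rfl⟩ : ∃ m, n = m + 1 := ⟨n - 1, by omega⟩
    rw [descProd_add_two, descProd_add_two]
    rcases Nat.lt_or_ge j (n + 1) with hlt | hge
    · rw [ih hlt, hgh _ hlt, mul_assoc]
    · obtain rfl : j = n + 1 := by omega
      rw [descProd_eq_one fun k h1 h2 => hh k h1 h2,
        descProd_eq_one fun k h1 h2 => hg k h1 (by omega), hg _ hj le_rfl]
      simp

end Products

/-! ## The bubble decomposition -/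

theorem s_apply {n i : ℕ} (h : 1 ≤ i ∧ i < n) (x : Fin n) :
    ((s n i x : Fin n) : ℕ) = if (x : ℕ) = i - 1 then i else if (x : ℕ) = i then i - 1 else x := by
  rw [s, dif_pos h, Equiv.swap_apply_def]
  simp only [Fin.ext_iff]
  split_ifs <;> rfl

/-- `s_a ⋯ s_b` moves the position `b + 1` to the position `a`. -/
theorem ascProd_s_apply {n a b : ℕ} (ha : 1 ≤ a) (hab : a ≤ b + 1) (hb : b < n) (x : Fin n) :
    ((ascProd (s n) a b x : Fin n) : ℕ) =
      if (x : ℕ) = b then a - 1 else if a - 1 ≤ (x : ℕ) ∧ (x : ℕ) < b then x + 1 else x := by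
  induction h : b + 1 - a generalizing a with
  | zero =>
    rw [ascProd_of_lt _ (by omega)]
    simp only [Equiv.Perm.coe_one, id_eq]
    split_ifs <;> omega
  | succ d ih =>
    rw [ascProd_eq_mul _ (by omega), Equiv.Perm.mul_apply, s_apply (by omega),
      ih (a := a + 1) (by omega) (by omega) (by omega)]
    split_ifs <;> omega

/-- The factor `σ^{(k)}` of a bubble decomposition. -/
def bubbleFactor (n : ℕ) (t : ℕ → ℕ) (k : ℕ) : Equiv.Perm (Fin n) :=
  if t k = 0 then 1 else ascProd (s n) (t k) k

theorem bubbleFactor_apply_of_lt {n k : ℕ} {t : ℕ → ℕ} (ht : t k ≤ k) (hk : k < n) {x : Fin n}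
    (hx : k < x) : bubbleFactor n t k x = x := by
  rw [bubbleFactor]
  split_ifs with h
  · rfl
  · ext
    rw [ascProd_s_apply (by omega) (by omega) hk]
    split_ifs <;> omega

theorem descProd_bubbleFactor_apply {n m : ℕ} {t : ℕ → ℕ} (ht : ∀ k, t k ≤ k) (hm : m ≤ n)
    {x : Fin n} (hx : m ≤ x) : descProd (bubbleFactor n t) m x = x := by
  induction m with
  | zero => simp [descProd_zero]
  | succ m ih =>
    cases m with
    | zero => simp [descProd_one]
    | succ m =>
      rw [descProd_add_two, Equiv.Perm.mul_apply, ih (by omega) (by omega),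
        bubbleFactor_apply_of_lt (ht _) (by omega) (by omega)]

/-- The lower factors fix the largest point that the top factor can move, so the image of that point
depends on the top factor alone and reveals its index. The top factor can then be cancelled. -/
theorem eq_of_descProd_bubbleFactor_eq {n m : ℕ} {t t' : ℕ → ℕ} (ht : ∀ k, t k ≤ k)
    (ht' : ∀ k, t' k ≤ k) (hm : m ≤ n)
    (h : descProd (bubbleFactor n t) m = descProd (bubbleFactor n t') m) :
    ∀ k < m, t k = t' k := by
  induction m with
  | zero => intro k hk; omega
  | succ m ih =>
    cases m with
    | zero =>
      intro k hk
      have := ht k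
      have := ht' k
      omega
    | succ m =>
      rw [descProd_add_two, descProd_add_two] at h
      have key : t (m + 1) = t' (m + 1) := by
        have h1 := congrArg (fun π : Equiv.Perm (Fin n) => ((π ⟨m + 1, by omega⟩ : Fin n) : ℕ)) h
        simp only [Equiv.Perm.mul_apply] at h1
        rw [descProd_bubbleFactor_apply ht (by omega) (by simp),
          descProd_bubbleFactor_apply ht' (by omega) (by simp)] at h1
        have h2 := ht (m + 1)
        have h3 := ht' (m + 1)
        have value : ∀ u : ℕ → ℕ, u (m + 1) ≤ m + 1 →
            ((bubbleFactor n u (m + 1) ⟨m + 1, by omega⟩ : Fin n) : ℕ) =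
              if u (m + 1) = 0 then m + 1 else u (m + 1) - 1 := by
          intro u hu
          rw [bubbleFactor]
          split_ifs with h0
          · simp
          · rw [ascProd_s_apply (by omega) (by omega) (by omega)]
            simp
        rw [value _ h2, value _ h3] at h1
        split_ifs at h1 <;> omega
      have hf : bubbleFactor n t (m + 1) = bubbleFactor n t' (m + 1) := by
        simp only [bubbleFactor, key]
      rw [hf] at h
      intro k hk
      rcases Nat.lt_or_ge k (m + 1) with hlt | hge
      · exact ih (by omega) (mul_left_cancel h) k hlt
      · obtain rfl : k = m + 1 := by omega
        exact key

theorem isBubble_unique {n : ℕ} {σ : Equiv.Perm (Fin n)} {t t' : ℕ → ℕ} (h : IsBubble σ t)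
    (h' : IsBubble σ t') : t = t' := by
  funext k
  rcases Nat.lt_or_ge k n with hlt | hge
  · exact eq_of_descProd_bubbleFactor_eq h.1 h'.1 le_rfl (h.2.2.symm.trans h'.2.2) k hlt
  · rw [h.2.1 k hge, h'.2.1 k hge]

/-- Since `bubble` is a choice, its values are accessible only through uniqueness. Existence is
needed, and proved below, for shuffles only. -/
theorem bubble_eq {n : ℕ} {σ : Equiv.Perm (Fin n)} {t : ℕ → ℕ} (h : IsBubble σ t) :
    bubble σ = t := by
  have hex : ∃ t, IsBubble σ t := ⟨t, h⟩
  rw [bubble, dif_pos hex]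
  exact isBubble_unique hex.choose_spec h

theorem isBubble_one (n : ℕ) : IsBubble (1 : Equiv.Perm (Fin n)) fun _ => 0 :=
  ⟨fun _ => Nat.zero_le _, fun _ _ => rfl, (descProd_eq_one fun _ _ _ => by simp).symm⟩

theorem isBubble_mul_ascProd {n a j : ℕ} {σ : Equiv.Perm (Fin n)} {t : ℕ → ℕ} (h : IsBubble σ t)
    (haj : a < j) (hj : j < n) (ht : ∀ k ≤ j, t k = 0) :
    IsBubble (σ * ascProd (s n) (a + 1) j) (Function.update t j (a + 1)) := by
  refine ⟨fun k => ?_, fun k hk => ?_, ?_⟩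
  · rcases eq_or_ne k j with rfl | hk
    · simpa using haj
    · simpa [hk] using h.1 k
  · rw [Function.update_of_ne (by omega)]
    exact h.2.1 k hk
  · rw [descProd_eq_mul (g := fun k => if t k = 0 then 1 else ascProd (s n) (t k) k)
      (j := j) (by omega) hj, ← h.2.2]
    · simp
    · intro k _ hk
      simp [ht k hk]
    · intro k _ hk
      simp [Function.update_of_ne hk.ne, ht k hk.le]
    · intro k hk
      simp [Function.update_of_ne hk.ne']

/-! ## Shuffles -/

section Shuffles

variable {n a p q : ℕ} {σ : Equiv.Perm (Fin n)}

theorem perm_eq_one_of_strictMono (h : StrictMono σ) : σ = 1 :=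
  σ.monotone_iff.1 h.monotone

theorem IsShuffle.le_apply (h : IsShuffle a p q σ) {i : Fin n} (hi : a ≤ i) : a ≤ (σ i : ℕ) := by
  by_contra hlt
  have := σ.injective (h.1 (σ i) (Or.inl (by omega)))
  rw [this] at hlt
  omega

theorem IsShuffle.apply_lt (h : IsShuffle a p q σ) {i : Fin n} (hi : (i : ℕ) < a + p + q) :
    (σ i : ℕ) < a + p + q := by
  by_contra hlt
  have := σ.injective (h.1 (σ i) (Or.inr (by omega)))
  rw [this] at hlt
  omega

theorem isShuffle_one (n a p q : ℕ) : IsShuffle a p q (1 : Equiv.Perm (Fin n)) :=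
  ⟨fun _ _ => rfl, fun _ _ _ h _ => h, fun _ _ _ h _ => h⟩

theorem IsShuffle.eq_one (h : IsShuffle a p q σ)
    (hmono : ∀ i j : Fin n, a ≤ i → i < j → (j : ℕ) < a + p + q → σ i < σ j) : σ = 1 := by
  apply perm_eq_one_of_strictMono
  intro i j hij
  have hij' : (i : ℕ) < j := hij
  rcases Nat.lt_or_ge i a with hi | hi
  · rw [h.1 i (Or.inl hi)]
    rcases Nat.lt_or_ge j a with hj | hj
    · rwa [h.1 j (Or.inl hj)]
    · have := h.le_apply hj
      exact Fin.lt_def.2 (by omega)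
  · rcases Nat.lt_or_ge j (a + p + q) with hj | hj
    · exact hmono i j hi hij hj
    · rw [h.1 j (Or.inr hj)]
      rcases Nat.lt_or_ge i (a + p + q) with hi' | hi'
      · have := h.apply_lt hi'
        exact Fin.lt_def.2 (by omega)
      · rwa [h.1 i (Or.inr hi')]

theorem IsShuffle.eq_one_of_left (h : IsShuffle a 0 q σ) : σ = 1 :=
  h.eq_one fun i j hi hij hj => h.2.2 i j hi hij hj

theorem IsShuffle.eq_one_of_right (h : IsShuffle a p 0 σ) : σ = 1 :=
  h.eq_one fun i j hi hij hj => h.2.1 i j hi hij hj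

/-- First case of the dichotomy: the first position of the left block stays first and can be handed
over to the fixed points. -/
theorem isShuffle_succ_left_iff (ha : a < n) :
    IsShuffle (a + 1) p q σ ↔ IsShuffle a (p + 1) q σ ∧ σ ⟨a, ha⟩ = ⟨a, ha⟩ := by
  constructor
  · intro h
    have hfix : σ ⟨a, ha⟩ = ⟨a, ha⟩ := h.1 _ (Or.inl (by simp))
    refine ⟨⟨fun i hi => h.1 i (by omega), fun i j hi hij hj => ?_,
      fun i j hi hij hj => h.2.2 i j (by omega) hij (by omega)⟩, hfix⟩
    have hij' : (i : ℕ) < j := hij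
    rcases Nat.lt_or_ge a i with hlt | hge
    · exact h.2.1 i j hlt hij (by omega)
    · obtain rfl : i = ⟨a, ha⟩ := Fin.ext (by simp; omega)
      have := h.le_apply (i := j) (by omega)
      rw [hfix]
      exact Fin.lt_def.2 (by simp; omega)
  · rintro ⟨h, hfix⟩
    refine ⟨fun i hi => ?_, fun i j hi hij hj => h.2.1 i j (by omega) hij (by omega),
      fun i j hi hij hj => h.2.2 i j (by omega) hij (by omega)⟩
    by_cases hia : (i : ℕ) = a
    · obtain rfl : i = ⟨a, ha⟩ := Fin.ext hia
      exact hfix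
    · exact h.1 i (by omega)

/-- The least value `a` of the shuffled range must be taken at the start of one of the two
increasing blocks; if not at the start of the first, then at the start of the second. -/
theorem IsShuffle.apply_mid_of_apply_ne (h : IsShuffle a (p + 1) (q + 1) σ)
    (hn : a + (p + 1) + (q + 1) ≤ n) (hne : σ ⟨a, by omega⟩ ≠ ⟨a, by omega⟩) :
    σ ⟨a + p + 1, by omega⟩ = ⟨a, by omega⟩ := by
  have ha : a < n := by omega
  have hap : a + p + 1 < n := by omega
  obtain ⟨i, hi⟩ := σ.surjective ⟨a, ha⟩
  have hia : a ≤ (i : ℕ) := by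
    by_contra hlt
    have := h.1 i (Or.inl (by omega))
    rw [hi] at this
    have := congrArg Fin.val this
    simp only at this
    omega
  have hib : (i : ℕ) < a + (p + 1) + (q + 1) := by
    by_contra hlt
    have := h.1 i (Or.inr (by omega))
    rw [hi] at this
    have := congrArg Fin.val this
    simp only at this
    omega
  have hne' : (i : ℕ) ≠ a := by
    intro hia
    obtain rfl : i = ⟨a, ha⟩ := Fin.ext hia
    exact hne hi
  have hge : a + p + 1 ≤ (i : ℕ) := by
    by_contra hlt
    have h1 := h.2.1 ⟨a, by omega⟩ i le_rfl (Fin.lt_def.2 (by simp; omega)) (by omega)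
    have h2 := h.le_apply (i := ⟨a, by omega⟩) le_rfl
    rw [hi, Fin.lt_def] at h1
    simp only at h1
    omega
  rcases hge.eq_or_lt with heq | hlt
  · obtain rfl : i = ⟨a + p + 1, hap⟩ := Fin.ext heq.symm
    exact hi
  · exfalso
    have h1 := h.2.2 ⟨a + p + 1, by omega⟩ i (by simp; omega) (Fin.lt_def.2 (by simpa using hlt))
      (by omega)
    have h2 := h.le_apply (i := ⟨a + p + 1, by omega⟩) (by simp; omega)
    rw [hi, Fin.lt_def] at h1
    simp only at h1
    omega

/-- Second case of the dichotomy: the cycle moves the first position of the right block in front of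
the whole left block, which shifts up by one. What remains is a shuffle of the shifted left block
with a right block shortened by one. -/
theorem isShuffle_mul_ascProd_iff (hn : a + (p + 1) + (q + 1) ≤ n) :
    IsShuffle (a + 1) (p + 1) q σ ↔
      IsShuffle a (p + 1) (q + 1) (σ * ascProd (s n) (a + 1) (a + p + 1)) ∧
        (σ * ascProd (s n) (a + 1) (a + p + 1)) ⟨a, by omega⟩ ≠ ⟨a, by omega⟩ := by
  have ha : a < n := by omega
  have hap : a + p + 1 < n := by omega
  set C := ascProd (s n) (a + 1) (a + p + 1) with hC
  have hCv : ∀ x : Fin n, ((C x : Fin n) : ℕ) = if (x : ℕ) = a + p + 1 then a else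
      if a ≤ (x : ℕ) ∧ (x : ℕ) < a + p + 1 then x + 1 else x := by
    intro x
    rw [hC, ascProd_s_apply (by omega) (by omega) (by omega)]
    simp
  have hlow : ∀ x : Fin n, (x : ℕ) < a → C x = x := fun x hx => Fin.ext (by
    rw [hCv]; split_ifs <;> omega)
  have hhigh : ∀ x : Fin n, a + p + 1 < (x : ℕ) → C x = x := fun x hx => Fin.ext (by
    rw [hCv]; split_ifs <;> omega)
  have hmid : ∀ x : Fin n, (h1 : a ≤ (x : ℕ)) → (h2 : (x : ℕ) < a + p + 1) →
      C x = ⟨x + 1, by omega⟩ := fun x h1 h2 => Fin.ext (by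
    rw [hCv]; simp only; split_ifs <;> omega)
  have hlast : C ⟨a + p + 1, by omega⟩ = ⟨a, by omega⟩ := Fin.ext (by rw [hCv]; simp)
  constructor
  · intro h
    refine ⟨⟨fun i hi => ?_, fun i j hi hij hj => ?_, fun i j hi hij hj => ?_⟩, ?_⟩
    · rw [Equiv.Perm.mul_apply]
      rcases hi with hi | hi
      · rw [hlow i hi]
        exact h.1 i (by omega)
      · rw [hhigh i (by omega)]
        exact h.1 i (by omega)
    · have hij' : (i : ℕ) < j := hij
      rw [Equiv.Perm.mul_apply, Equiv.Perm.mul_apply, hmid i hi (by omega),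
        hmid j (by omega) (by omega)]
      exact h.2.1 _ _ (by simp; omega) (Fin.lt_def.2 (by simp; omega)) (by simp; omega)
    · have hij' : (i : ℕ) < j := hij
      rw [Equiv.Perm.mul_apply, Equiv.Perm.mul_apply, hhigh j (by omega)]
      rcases Nat.lt_or_ge (a + p + 1) i with hlt | hge
      · rw [hhigh i hlt]
        exact h.2.2 i j (by omega) hij (by omega)
      · obtain rfl : i = ⟨a + p + 1, hap⟩ := Fin.ext (by simp; omega)
        rw [hlast, h.1 _ (Or.inl (by simp))]
        have := h.le_apply (i := j) (by omega)
        exact Fin.lt_def.2 (by simp; omega)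
    · rw [Equiv.Perm.mul_apply, hmid _ (by simp) (by simp only; omega)]
      intro heq
      have h1 := h.le_apply (i := ⟨a + 1, by omega⟩) le_rfl
      rw [heq] at h1
      simp only at h1
      omega
  · rintro ⟨h, hne⟩
    have h0 := h.apply_mid_of_apply_ne hn hne
    rw [Equiv.Perm.mul_apply, hlast] at h0
    have hσ : ∀ x : Fin n, a + 1 ≤ (x : ℕ) → (x : ℕ) < a + p + 2 →
        σ x = (σ * C) ⟨x - 1, by omega⟩ := by
      intro x h1 h2
      rw [Equiv.Perm.mul_apply, hmid _ (by simp; omega) (by simp; omega)]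
      congr 1
      exact Fin.ext (by simp; omega)
    have hσ' : ∀ x : Fin n, a + p + 2 ≤ (x : ℕ) → σ x = (σ * C) x := by
      intro x h1
      rw [Equiv.Perm.mul_apply, hhigh _ (by omega)]
    refine ⟨fun i hi => ?_, fun i j hi hij hj => ?_, fun i j hi hij hj => ?_⟩
    · rcases hi with hi | hi
      · by_cases hia : (i : ℕ) = a
        · obtain rfl : i = ⟨a, ha⟩ := Fin.ext hia
          exact h0
        · have := h.1 i (by omega)
          rwa [Equiv.Perm.mul_apply, hlow i (by omega)] at this
      · rw [hσ' i (by omega)]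
        exact h.1 i (by omega)
    · have hij' : (i : ℕ) < j := hij
      rw [hσ i (by omega) (by omega), hσ j (by omega) (by omega)]
      exact h.2.1 _ _ (by simp; omega) (Fin.lt_def.2 (by simp; omega)) (by simp; omega)
    · have hij' : (i : ℕ) < j := hij
      rw [hσ' i (by omega), hσ' j (by omega)]
      exact h.2.2 i j (by omega) hij (by omega)

/-- Induction on `p + q` along the dichotomy. In the second case the smaller shuffle has `t k = 0`
for all `k < a + p + 2`, so slot `a + p + 1` is free for the new cycle. The bound on `t (a + p)` is
what later separates the two cases. -/
theorem IsShuffle.exists_isBubble (h : IsShuffle a p q σ) (hn : a + p + q ≤ n) :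
    ∃ t, IsBubble σ t ∧ (∀ k < a + p, t k = 0) ∧ (t (a + p) = 0 ∨ a + 1 ≤ t (a + p)) := by
  induction hd : p + q generalizing a p q σ with
  | zero =>
    obtain rfl : p = 0 := by omega
    exact ⟨_, h.eq_one_of_left ▸ isBubble_one n, fun _ _ => rfl, Or.inl rfl⟩
  | succ d ih =>
    cases p with
    | zero => exact ⟨_, h.eq_one_of_left ▸ isBubble_one n, fun _ _ => rfl, Or.inl rfl⟩
    | succ p =>
      cases q with
      | zero => exact ⟨_, h.eq_one_of_right ▸ isBubble_one n, fun _ _ => rfl, Or.inl rfl⟩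
      | succ q =>
        by_cases hfix : σ ⟨a, by omega⟩ = ⟨a, by omega⟩
        · obtain ⟨t, h1, h2, h3⟩ := ih ((isShuffle_succ_left_iff (by omega)).2 ⟨h, hfix⟩)
            (by omega) (by omega)
          rw [show a + 1 + p = a + (p + 1) by omega] at h2 h3
          exact ⟨t, h1, h2, by omega⟩
        · obtain ⟨σ', rfl⟩ : ∃ σ', σ = σ' * ascProd (s n) (a + 1) (a + p + 1) :=
            ⟨σ * (ascProd (s n) (a + 1) (a + p + 1))⁻¹, by simp⟩
          obtain ⟨t, h1, h2, h3⟩ := ih ((isShuffle_mul_ascProd_iff hn).2 ⟨h, hfix⟩)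
            (by omega) (by omega)
          refine ⟨_, isBubble_mul_ascProd h1 (by omega) (by omega) fun k hk => h2 k (by omega),
            fun k hk => ?_, Or.inr ?_⟩
          · rw [Function.update_of_ne (by omega)]
            exact h2 k (by omega)
          · rw [show a + (p + 1) = a + p + 1 by omega]
            simp

theorem IsShuffle.bubble_eq_zero (h : IsShuffle a p q σ) (hn : a + p + q ≤ n) {k : ℕ}
    (hk : k < a + p) : bubble σ k = 0 := by
  obtain ⟨t, h1, h2, -⟩ := h.exists_isBubble hn
  rw [bubble_eq h1, h2 k hk]

theorem IsShuffle.isBubble (h : IsShuffle a p q σ) (hn : a + p + q ≤ n) :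
    IsBubble σ (bubble σ) := by
  obtain ⟨t, h1, -⟩ := h.exists_isBubble hn
  rwa [bubble_eq h1]

theorem IsShuffle.bubble_mul_ascProd (h : IsShuffle (a + 1) (p + 1) q σ)
    (hn : a + (p + 1) + (q + 1) ≤ n) :
    bubble (σ * ascProd (s n) (a + 1) (a + p + 1)) =
      Function.update (bubble σ) (a + p + 1) (a + 1) :=
  bubble_eq (isBubble_mul_ascProd (h.isBubble (by omega)) (by omega) (by omega)
    fun _ hk => h.bubble_eq_zero (by omega) (by omega))

/-- This translates the Kronecker delta of the lift into the dichotomy: the lowest possible bubble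
reaches down to `a + 1` exactly when the 0-based point `a` is moved. -/
theorem IsShuffle.bubble_eq_iff (h : IsShuffle a (p + 1) q σ) (hn : a + (p + 1) + q ≤ n) :
    bubble σ (a + p + 1) = a + 1 ↔ ¬IsShuffle (a + 1) p q σ := by
  constructor
  · intro hb h'
    obtain ⟨t, h1, -, h3⟩ := h'.exists_isBubble (by omega)
    rw [bubble_eq h1] at hb
    rw [show a + 1 + p = a + p + 1 by omega] at h3
    omega
  · intro h'
    cases q with
    | zero =>
      obtain rfl := h.eq_one_of_right
      exact absurd (isShuffle_one _ _ _ _) h'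
    | succ q =>
      obtain ⟨σ', rfl⟩ : ∃ σ', σ = σ' * ascProd (s n) (a + 1) (a + p + 1) :=
        ⟨σ * (ascProd (s n) (a + 1) (a + p + 1))⁻¹, by simp⟩
      rw [isShuffle_succ_left_iff (by omega)] at h'
      rw [((isShuffle_mul_ascProd_iff hn).2 ⟨h, fun hf => h' ⟨h, hf⟩⟩).bubble_mul_ascProd hn]
      simp

end Shuffles

/-! ## The sum of the lifts of all shuffles -/

section ShuffleSum

variable (K : Type*) [Field K] {n : ℕ}

theorem bubbleLift_one : bubbleLift K (1 : Equiv.Perm (Fin n)) = 1 := by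
  rw [bubbleLift, bubble_eq (isBubble_one n)]
  exact descProd_eq_one fun _ _ _ => by simp

/-- The lifted factor of index `k` depends only on `t k` and `t (k + 1)`, so a new lowest bubble
does not disturb the factors above it; only its own delta looks at the old indices. -/
theorem IsShuffle.bubbleLift_mul_ascProd {a p q : ℕ} {σ : Equiv.Perm (Fin n)}
    (h : IsShuffle (a + 1) (p + 1) q σ) (hn : a + (p + 1) + (q + 1) ≤ n) :
    bubbleLift K (σ * ascProd (s n) (a + 1) (a + p + 1)) =
      bubbleLift K σ * ((sigA K n (a + 1) +
        (if a + 2 = bubble σ (a + p + 2) then 0 else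
          ascProd (sigA K n) 1 a * xiA K n (a + 1))) *
        ascProd (sigA K n) (a + 2) (a + p + 1)) := by
  rw [bubbleLift, bubbleLift, h.bubble_mul_ascProd hn]
  have hz : ∀ k ≤ a + p + 1, bubble σ k = 0 := fun k hk => h.bubble_eq_zero (by omega) (by omega)
  refine (descProd_eq_mul (g := fun k => if bubble σ k = 0 then 1
      else (sigA K n (bubble σ k) + (if bubble σ k + 1 = bubble σ (k + 1) then 0
        else ascProd (sigA K n) 1 (bubble σ k - 1) * xiA K n (bubble σ k))) *
      ascProd (sigA K n) (bubble σ k + 1) k) (j := a + p + 1) (by omega) (by omega)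
      ?_ ?_ ?_).trans ?_
  · intro k _ hk
    simp [hz k hk]
  · intro k _ hk
    simp [Function.update_of_ne hk.ne, hz k hk.le]
  · intro k hk
    simp [Function.update_of_ne hk.ne', Function.update_of_ne (show k + 1 ≠ a + p + 1 by omega)]
  · simp

open Classical in
/-- The sum of the lifts of the permutations in `𝔖_{p,q}^{↑a} ⊂ 𝔖_n`. -/
noncomputable def shuffleSum (n a p q : ℕ) : MonoidAlgebra K (GVB n) :=
  ∑ σ : Equiv.Perm (Fin n) with IsShuffle a p q σ, bubbleLift K σ

theorem shuffleSum_zero_left (a q : ℕ) : shuffleSum K n a 0 q = 1 := by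
  classical
  rw [shuffleSum, Finset.sum_eq_single 1]
  · exact bubbleLift_one K
  · intro σ hσ hne
    exact absurd (Finset.mem_filter.1 hσ).2.eq_one_of_left hne
  · intro h
    exact absurd (Finset.mem_filter.2 ⟨Finset.mem_univ _, isShuffle_one _ _ _ _⟩) h

theorem shuffleSum_zero_right (a p : ℕ) : shuffleSum K n a p 0 = 1 := by
  classical
  rw [shuffleSum, Finset.sum_eq_single 1]
  · exact bubbleLift_one K
  · intro σ hσ hne
    exact absurd (Finset.mem_filter.1 hσ).2.eq_one_of_right hne
  · intro h
    exact absurd (Finset.mem_filter.2 ⟨Finset.mem_univ _, isShuffle_one _ _ _ _⟩) h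

/-- The shuffles that fix the 0-based point `a` give the first term. The others are right multiples
of a cycle; the `σ` and `ξ` parts of its lift give the second and third terms. -/
theorem shuffleSum_succ_succ (a p q : ℕ) (hn : a + (p + 1) + (q + 1) ≤ n) :
    shuffleSum K n a (p + 1) (q + 1) =
      shuffleSum K n (a + 1) p (q + 1) +
      shuffleSum K n (a + 1) (p + 1) q * ascProd (sigA K n) (a + 1) (a + p + 1) +
      shuffleSum K n (a + 2) p q * (ascProd (sigA K n) 1 a * xiA K n (a + 1) *
        ascProd (sigA K n) (a + 2) (a + p + 1)) := by
  classical
  have ha : a < n := by omega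
  rw [shuffleSum, ← Finset.sum_filter_add_sum_filter_not _ fun σ => σ ⟨a, ha⟩ = ⟨a, ha⟩, add_assoc]
  congr 1
  · rw [Finset.filter_filter, shuffleSum]
    refine Finset.sum_congr (Finset.filter_congr fun σ _ => ?_) fun _ _ => rfl
    rw [isShuffle_succ_left_iff ha]
  · have h1 : ∑ σ ∈ {σ ∈ {σ : Equiv.Perm (Fin n) | IsShuffle a (p + 1) (q + 1) σ} |
          ¬σ ⟨a, ha⟩ = ⟨a, ha⟩}, bubbleLift K σ =
        ∑ σ : Equiv.Perm (Fin n) with IsShuffle (a + 1) (p + 1) q σ,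
          bubbleLift K (σ * ascProd (s n) (a + 1) (a + p + 1)) := by
      symm
      refine Finset.sum_equiv (Equiv.mulRight (ascProd (s n) (a + 1) (a + p + 1)))
        (fun σ => ?_) fun _ _ => rfl
      simp [isShuffle_mul_ascProd_iff hn]
    rw [h1, Finset.sum_congr rfl fun σ hσ =>
      (Finset.mem_filter.1 hσ).2.bubbleLift_mul_ascProd K hn]
    simp only [add_mul, mul_add, Finset.sum_add_distrib]
    congr 1
    · rw [shuffleSum, Finset.sum_mul, ascProd_eq_mul (sigA K n) (a := a + 1) (by omega)]
    · rw [shuffleSum, Finset.sum_mul]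
      -- By `IsShuffle.bubble_eq_iff` the delta vanishes precisely on the shuffles that also fix the
      -- next point, which explains the jump from `a + 1` to `a + 2`.
      have h2 : Finset.univ.filter (fun σ : Equiv.Perm (Fin n) => IsShuffle (a + 2) p q σ) =
          (Finset.univ.filter fun σ : Equiv.Perm (Fin n) => IsShuffle (a + 1) (p + 1) q σ).filter
            fun σ => ¬ a + 2 = bubble σ (a + p + 2) := by
        rw [Finset.filter_filter]
        refine Finset.filter_congr fun σ _ => ⟨fun h => ?_, fun ⟨h, h'⟩ => ?_⟩
        · have h' := ((isShuffle_succ_left_iff (show a + 1 < n by omega)).1 h).1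
          refine ⟨h', fun hb => ?_⟩
          refine (h'.bubble_eq_iff (by omega)).1 ?_ h
          rw [show a + 1 + p + 1 = a + p + 2 by omega, ← hb]
        · by_contra hc
          apply h'
          rw [show a + p + 2 = a + 1 + p + 1 by omega, (h.bubble_eq_iff (by omega)).2 hc]
      rw [h2, Finset.sum_filter (p := fun σ => ¬ a + 2 = bubble σ (a + p + 2))]
      refine Finset.sum_congr rfl fun σ _ => ?_
      split_ifs <;> simp_all

end ShuffleSum

end GenMatsumotoTits

namespace GenMatsumotoTits

/-! ## Factorization of permutations into shuffles -/

section Factorization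

variable {n : ℕ}

theorem apply_lt_of_fixes {ρ : Equiv.Perm (Fin n)} {P : ℕ} (hρ : ∀ i : Fin n, P ≤ i → ρ i = i)
    {i : Fin n} (hi : (i : ℕ) < P) : (ρ i : ℕ) < P := by
  by_contra hlt
  have := ρ.injective (hρ (ρ i) (by omega))
  rw [this] at hlt
  omega

/-- Sorting the values of `σ` on the first `P` positions turns it into a shuffle, because it is
already increasing on the remaining block. -/
theorem exists_isShuffle_mul {σ : Equiv.Perm (Fin n)} {P Q : ℕ} (hPQ : P ≤ Q) (hQ : Q ≤ n)
    (hfix : ∀ i : Fin n, Q ≤ i → σ i = i)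
    (hmono : ∀ i j : Fin n, P ≤ i → i < j → (j : ℕ) < Q → σ i < σ j) :
    ∃ w ρ : Equiv.Perm (Fin n), w * ρ = σ ∧ IsShuffle 0 P (Q - P) w ∧
      ∀ i : Fin n, P ≤ i → ρ i = i := by
  have hP : P ≤ n := hPQ.trans hQ
  let f : Fin P → Fin n := fun x => σ (Fin.castLE hP x)
  have hf : StrictMono (f ∘ Tuple.sort f) :=
    (Tuple.monotone_sort f).strictMono_of_injective
      ((σ.injective.comp (Fin.castLE_injective hP)).comp (Tuple.sort f).injective)
  -- The sorting permutation of the first `P` positions, extended by the identity; the factors are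
  -- `w = σ * T` and `ρ = T⁻¹`.
  let T : Equiv.Perm (Fin n) := (Tuple.sort f).extendDomain (Fin.castLEOrderIso hP).toEquiv
  have hT1 : ∀ x : Fin P, T (Fin.castLE hP x) = Fin.castLE hP (Tuple.sort f x) := fun x =>
    Equiv.Perm.extendDomain_apply_image (Tuple.sort f) (Fin.castLEOrderIso hP).toEquiv x
  have hT2 : ∀ i : Fin n, P ≤ i → T i = i := fun i hi =>
    Equiv.Perm.extendDomain_apply_not_subtype _ _ (by simpa using hi)
  refine ⟨σ * T, T⁻¹, by simp, ⟨fun i hi => ?_, fun i j hi hij hj => ?_,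
    fun i j hi hij hj => ?_⟩, fun i hi => ?_⟩
  · rw [Equiv.Perm.mul_apply, hT2 i (by omega), hfix i (by omega)]
  · have hij' : (i : ℕ) < j := hij
    have := hf (show (⟨i, by omega⟩ : Fin P) < ⟨j, by omega⟩ from hij')
    simp only [Function.comp_apply, f, ← hT1] at this
    exact this
  · have hij' : (i : ℕ) < j := hij
    rw [Equiv.Perm.mul_apply, Equiv.Perm.mul_apply, hT2 i (by omega), hT2 j (by omega)]
    exact hmono i j (by omega) hij (by omega)
  · rw [Equiv.Perm.inv_eq_iff_eq, hT2 i hi]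

/-- The quotient `w'⁻¹ * w = ρ' * ρ⁻¹` fixes all positions from `P` on, and it is increasing below
`P` since both `w` and `w'` are; hence it is the identity. -/
theorem isShuffle_mul_unique {w w' ρ ρ' : Equiv.Perm (Fin n)} {P q q' : ℕ}
    (hw : IsShuffle 0 P q w) (hw' : IsShuffle 0 P q' w') (hρ : ∀ i : Fin n, P ≤ i → ρ i = i)
    (hρ' : ∀ i : Fin n, P ≤ i → ρ' i = i) (h : w * ρ = w' * ρ') : w = w' := by
  have hπ : w'⁻¹ * w = ρ' * ρ⁻¹ := by
    rw [inv_mul_eq_iff_eq_mul, ← mul_assoc, ← h, mul_inv_cancel_right]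
  have hfix : ∀ i : Fin n, P ≤ i → (w'⁻¹ * w) i = i := fun i hi => by
    rw [hπ, Equiv.Perm.mul_apply, Equiv.Perm.inv_eq_iff_eq.2 (hρ i hi).symm, hρ' i hi]
  have hval : ∀ i, w' ((w'⁻¹ * w) i) = w i := fun i => by simp
  have h1 : IsShuffle 0 P 0 (w'⁻¹ * w) := by
    refine ⟨fun i hi => hfix i (by omega), fun i j hi hij hj => ?_,
      fun i j hi hij hj => by omega⟩
    have hij' : (i : ℕ) < j := hij
    by_contra hle
    rcases (not_lt.1 hle).eq_or_lt with heq | hlt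
    · exact hij.ne' ((w'⁻¹ * w).injective heq)
    · have h2 := hw'.2.1 _ _ (Nat.zero_le _) hlt
        (by simpa using apply_lt_of_fixes hfix (i := i) (by omega))
      rw [hval, hval] at h2
      exact lt_asymm h2 (hw.2.1 i j hi hij hj)
  exact (inv_mul_eq_one.1 h1.eq_one_of_right).symm

/-- `σ` fixes all positions beyond the first `P k` ones and is increasing on the consecutive blocks
of positions that end at `P 0`, …, `P k`. -/
def IsBlockMono (P : ℕ → ℕ) (k : ℕ) (σ : Equiv.Perm (Fin n)) : Prop :=
  (∀ i : Fin n, P k ≤ i → σ i = i) ∧ (∀ i j : Fin n, i < j → (j : ℕ) < P 0 → σ i < σ j) ∧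
    ∀ m < k, ∀ i j : Fin n, P m ≤ i → i < j → (j : ℕ) < P (m + 1) → σ i < σ j

/-- A sequence of shuffles of growing initial segments of positions. -/
def IsShuffleSeq (P : ℕ → ℕ) {k : ℕ} (w : Fin k → Equiv.Perm (Fin n)) : Prop :=
  ∀ l : Fin k, IsShuffle 0 (P l) (P (l + 1) - P l) (w l)

theorem prod_reverse_ofFn_succ {M : Type*} [Monoid M] {k : ℕ} (w : Fin (k + 1) → M) :
    (List.ofFn w).reverse.prod =
      w (Fin.last k) * (List.ofFn fun i => w (Fin.castSucc i)).reverse.prod := by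
  rw [List.ofFn_succ', List.concat_eq_append, List.reverse_append]
  simp

variable {P : ℕ → ℕ}

theorem IsShuffleSeq.castSucc {k : ℕ} {w : Fin (k + 1) → Equiv.Perm (Fin n)} (h : IsShuffleSeq P w) :
    IsShuffleSeq P fun i : Fin k => w (Fin.castSucc i) :=
  fun l => h (Fin.castSucc l)

/-- The inner product permutes the first `P k` positions, where the last shuffle is increasing, so
order relations obtained there persist. On the new block the inner product is the identity. -/
theorem IsShuffleSeq.isBlockMono (hP : Monotone P) {k : ℕ} {w : Fin k → Equiv.Perm (Fin n)}
    (h : IsShuffleSeq P w) : IsBlockMono P k (List.ofFn w).reverse.prod := by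
  induction k with
  | zero => exact ⟨fun _ _ => by simp, fun _ _ h _ => by simpa using h, fun _ h => by omega⟩
  | succ k ih =>
    rw [prod_reverse_ofFn_succ]
    have hw : IsShuffle 0 (P k) (P (k + 1) - P k) (w (Fin.last k)) := h (Fin.last k)
    generalize w (Fin.last k) = w₁ at hw
    obtain ⟨h1, h2, h3⟩ := ih h.castSucc
    generalize (List.ofFn fun i => w (Fin.castSucc i)).reverse.prod = ρ at h1 h2 h3
    have hk : P k ≤ P (k + 1) := hP (Nat.le_succ k)
    have up : ∀ i j : Fin n, ρ i < ρ j → (j : ℕ) < P k → (w₁ * ρ) i < (w₁ * ρ) j :=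
      fun i j hij hj => hw.2.1 _ _ (Nat.zero_le _) hij (by simpa using apply_lt_of_fixes h1 hj)
    refine ⟨fun i hi => ?_, fun i j hij hj => ?_, fun m hm i j hi hij hj => ?_⟩
    · rw [Equiv.Perm.mul_apply, h1 i (by omega), hw.1 i (by omega)]
    · exact up i j (h2 i j hij hj) (hj.trans_le (hP (Nat.zero_le k)))
    · rcases Nat.lt_or_ge m k with hlt | hge
      · exact up i j (h3 m hlt i j hi hij hj) (hj.trans_le (hP hlt))
      · obtain rfl : m = k := by omega
        have hij' : (i : ℕ) < j := hij
        rw [Equiv.Perm.mul_apply, Equiv.Perm.mul_apply, h1 i hi, h1 j (by omega)]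
        exact hw.2.2 i j (by omega) hij (by omega)

theorem IsShuffleSeq.unique (hP : Monotone P) {k : ℕ} {w w' : Fin k → Equiv.Perm (Fin n)}
    (h : IsShuffleSeq P w) (h' : IsShuffleSeq P w')
    (heq : (List.ofFn w).reverse.prod = (List.ofFn w').reverse.prod) : w = w' := by
  induction k with
  | zero => exact Subsingleton.elim _ _
  | succ k ih =>
    rw [prod_reverse_ofFn_succ, prod_reverse_ofFn_succ] at heq
    have hlast : w (Fin.last k) = w' (Fin.last k) :=
      isShuffle_mul_unique (h (Fin.last k)) (h' (Fin.last k))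
        (h.castSucc.isBlockMono hP).1 (h'.castSucc.isBlockMono hP).1 heq
    rw [hlast] at heq
    have hinit := ih h.castSucc h'.castSucc (mul_left_cancel heq)
    funext i
    induction i using Fin.lastCases with
    | last => exact hlast
    | cast i => exact congrFun hinit i

/-- The outermost shuffle is split off first. As it is increasing on the first `P k` positions, the
remaining factor inherits monotonicity on the earlier blocks. -/
theorem IsBlockMono.exists_isShuffleSeq (hP : Monotone P) {k : ℕ} (hk : P k ≤ n)
    {σ : Equiv.Perm (Fin n)} (h : IsBlockMono P k σ) :
    ∃ w : Fin k → Equiv.Perm (Fin n), IsShuffleSeq P w ∧ (List.ofFn w).reverse.prod = σ := by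
  induction k generalizing σ with
  | zero =>
    refine ⟨Fin.elim0, fun l => l.elim0, ?_⟩
    have : IsShuffle 0 (P 0) 0 σ :=
      ⟨fun i hi => h.1 i (by omega), fun i j _ hij hj => h.2.1 i j hij (by omega),
        fun i j _ hij hj => by have : (i : ℕ) < j := hij; omega⟩
    simpa using this.eq_one_of_right.symm
  | succ k ih =>
    have hkk : P k ≤ P (k + 1) := hP (Nat.le_succ k)
    obtain ⟨w₁, ρ, hσ, hw₁, hρ⟩ := exists_isShuffle_mul hkk hk h.1
      fun i j hi hij hj => h.2.2 k (Nat.lt_succ_self k) i j hi hij hj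
    have down : ∀ i j : Fin n, i < j → (j : ℕ) < P k → σ i < σ j → ρ i < ρ j := by
      intro i j hij hj hlt
      have hij' : (i : ℕ) < j := hij
      by_contra hle
      rcases (not_lt.1 hle).eq_or_lt with heq | hlt'
      · exact hij.ne' (ρ.injective heq)
      · have := hw₁.2.1 _ _ (Nat.zero_le _) hlt'
          (by simpa using apply_lt_of_fixes hρ (i := i) (by omega))
        rw [← Equiv.Perm.mul_apply, ← Equiv.Perm.mul_apply, hσ] at this
        exact lt_asymm this hlt
    have hmono : IsBlockMono P k ρ :=
      ⟨hρ, fun i j hij hj => down i j hij (hj.trans_le (hP (Nat.zero_le k))) (h.2.1 i j hij hj),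
        fun m hm i j hi hij hj => down i j hij (hj.trans_le (hP hm))
          (h.2.2 m (by omega) i j hi hij hj)⟩
    obtain ⟨w, hw, hwρ⟩ := ih (hkk.trans hk) hmono
    refine ⟨Fin.snoc (α := fun _ => Equiv.Perm (Fin n)) w w₁, fun l => ?_, ?_⟩
    · induction l using Fin.lastCases with
      | last => simpa using hw₁
      | cast l => simpa using hw l
    · rw [prod_reverse_ofFn_succ]
      simp [hwρ, hσ]

end Factorization

/-! ## Descents and compositions -/

section Descents

variable {n : ℕ}

theorem mem_iff_exists_sizeUpTo_compositionOf (I : Finset (Fin (n - 1))) (i : Fin (n - 1)) :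
    i ∈ I ↔ ∃ j ≤ (compositionOf I).length, (compositionOf I).sizeUpTo j = i + 1 := by
  set c := compositionOf I with hc
  have h1 : compositionAsSetEquiv n c.toCompositionAsSet = I := by
    have : c.toCompositionAsSet = compositionEquiv n c := rfl
    rw [this, hc, compositionOf]
    simp
  conv_lhs => rw [← h1]
  simp only [compositionAsSetEquiv, Equiv.coe_fn_mk, Set.mem_toFinset, Set.mem_ofPred_eq,
    Composition.toCompositionAsSet_boundaries, Composition.boundaries, Finset.mem_map,
    Finset.mem_univ, true_and, Composition.boundary, OrderEmbedding.coe_ofStrictMono,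
    RelEmbedding.coe_toEmbedding, Fin.ext_iff]
  constructor
  · rintro ⟨j, hj⟩
    exact ⟨j, by omega, by omega⟩
  · rintro ⟨j, hj, hj'⟩
    exact ⟨⟨j, by omega⟩, by simp only; omega⟩

theorem length_compositionOf_pos (hn : 1 ≤ n) (I : Finset (Fin (n - 1))) :
    0 < (compositionOf I).length :=
  (compositionOf I).length_pos_of_pos hn

/-- The end of the block of index `l`. -/
def blockEnd (c : Composition n) (l : ℕ) : ℕ := c.sizeUpTo (l + 1)

theorem monotone_blockEnd (c : Composition n) : Monotone (blockEnd c) :=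
  fun _ _ h => c.monotone_sizeUpTo (by omega)

theorem blockEnd_last (hn : 1 ≤ n) (c : Composition n) : blockEnd c (c.length - 1) = n := by
  have := c.length_pos_of_pos hn
  rw [blockEnd, Nat.sub_add_cancel this, c.sizeUpTo_length]

theorem leftSize_eq (c : Composition n) (l : Fin (c.length - 1)) : leftSize c l = blockEnd c l :=
  rfl

theorem blockEnd_succ (c : Composition n) (l : Fin (c.length - 1)) :
    blockEnd c (l + 1) = leftSize c l + rightSize c l :=
  c.sizeUpTo_succ (by omega)

theorem isShuffleDecomp_iff (c : Composition n) (σ : Equiv.Perm (Fin n))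
    (w : Fin (c.length - 1) → Equiv.Perm (Fin n)) :
    IsShuffleDecomp c σ w ↔ IsShuffleSeq (blockEnd c) w ∧ (List.ofFn w).reverse.prod = σ := by
  refine and_congr_left fun _ => forall_congr' fun l => ?_
  rw [blockEnd_succ, ← leftSize_eq, Nat.add_sub_cancel_left]

theorem apply_lt_apply_of_steps {σ : Equiv.Perm (Fin n)} {i j : Fin n} (hij : i < j)
    (h : ∀ x : ℕ, (i : ℕ) ≤ x → (hx : x < j) → σ ⟨x, by omega⟩ < σ ⟨x + 1, by omega⟩) :
    σ i < σ j := by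
  obtain ⟨i, hi⟩ := i
  obtain ⟨j, hj⟩ := j
  have hij' : i < j := hij
  obtain ⟨d, rfl⟩ : ∃ d, j = i + d + 1 := ⟨j - i - 1, by omega⟩
  induction d with
  | zero => exact h i le_rfl hij'
  | succ d ih =>
    exact (ih (by omega) (Fin.lt_def.2 (by simp only; omega))
      (fun x h1 h2 => h x h1 (by simp only at h2 ⊢; omega)) (by omega)).trans
      (h (i + d + 1) (by simp only; omega) (by simp only; omega))

/-- The elements of `I` are the inner block ends, so having no descent outside `I` amounts to
increasing at every adjacent pair inside a block. -/
theorem mem_desLE_iff (hn : 1 ≤ n) (I : Finset (Fin (n - 1))) (σ : Equiv.Perm (Fin n)) :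
    σ ∈ desLE I ↔
      IsBlockMono (blockEnd (compositionOf I)) ((compositionOf I).length - 1) σ := by
  have hI := mem_iff_exists_sizeUpTo_compositionOf I
  have hpos := length_compositionOf_pos hn I
  have hend := blockEnd_last hn (compositionOf I)
  generalize compositionOf I = c at *
  have hmem : σ ∈ desLE I ↔ ∀ i : Fin (n - 1), i ∉ I →
      σ ⟨i, by omega⟩ < σ ⟨i + 1, by omega⟩ := by
    simp only [desLE, descents, Finset.mem_filter, Finset.mem_univ, true_and,
      Finset.subset_iff]
    refine forall_congr' fun i => ?_
    rw [← not_imp_not, not_lt]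
    refine imp_congr_right fun _ => ⟨fun h => h.lt_of_ne fun he => ?_, le_of_lt⟩
    have := congrArg Fin.val (σ.injective he)
    simp at this
  rw [hmem]
  constructor
  · intro h
    have block : ∀ m < c.length, ∀ i j : Fin n, c.sizeUpTo m ≤ i → i < j →
        (j : ℕ) < c.sizeUpTo (m + 1) → σ i < σ j := by
      intro m hm i j hi hij hj
      refine apply_lt_apply_of_steps hij fun x hx1 hx2 => ?_
      refine h ⟨x, by omega⟩ fun hxI => ?_
      -- A descent allowed by `I` between two positions of block `m` would be a block end strictly
      -- inside that block.
      obtain ⟨b, hb, hbx⟩ := (hI _).1 hxI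
      simp only at hbx
      rcases Nat.lt_or_ge m b with hlt | hge
      · have := c.monotone_sizeUpTo (show m + 1 ≤ b from hlt)
        omega
      · have := c.monotone_sizeUpTo hge
        omega
    refine ⟨fun i hi => by omega, fun i j hij hj => block 0 hpos i j (by simp) hij hj,
      fun m hm i j hi hij hj => block (m + 1) (by omega) i j hi hij hj⟩
  · rintro ⟨-, h1, h2⟩ i hi
    have hlow := c.sizeUpTo_index_le ⟨i, by omega⟩
    have hup : (i : ℕ) < c.sizeUpTo (c.index ⟨i, by omega⟩ + 1) :=
      c.lt_sizeUpTo_index_succ ⟨i, by omega⟩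
    have hidx := (c.index ⟨i, by omega⟩).2
    generalize (c.index ⟨i, by omega⟩ : ℕ) = m at hlow hup hidx
    -- Since `i` is not in `I`, its block does not end there, so `i + 1` lies in the same block.
    have hne : c.sizeUpTo (m + 1) ≠ i + 1 := fun he => hi ((hI i).2 ⟨m + 1, hidx, he⟩)
    simp only at hlow
    cases m with
    | zero => exact h1 _ _ (Fin.lt_def.2 (by simp)) (by simp only [blockEnd]; omega)
    | succ m =>
      exact h2 m (by omega) _ _ (by simpa [blockEnd] using hlow) (Fin.lt_def.2 (by simp))
        (by simp only [blockEnd]; omega)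

end Descents

/-! ## Sums over iterated shuffles -/

section IteratedSum

theorem foldl_sum {ι α E : Type*} [AddCommMonoid E] (L : List ι) (f : ι → E →+ E)
    (s : Finset α) (x : α → E) :
    L.foldl (fun y l => f l y) (∑ a ∈ s, x a) = ∑ a ∈ s, L.foldl (fun y l => f l y) (x a) := by
  induction L generalizing x with
  | nil => rfl
  | cons l L ih => simp [map_sum, ih]

/-- Distributivity for a composite of sums of additive maps: expanding it amounts to choosing one
summand at each stage. -/
theorem sum_piFinset_foldl {α E : Type*} [AddCommMonoid E] {k : ℕ} (S : Fin k → Finset α)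
    (f : Fin k → α → E →+ E) (x : E) :
    ∑ w ∈ Fintype.piFinset S, (List.finRange k).foldl (fun y l => f l (w l) y) x =
      (List.finRange k).foldl (fun y l => ∑ a ∈ S l, f l a y) x := by
  induction k generalizing x with
  | zero => simp
  | succ k ih =>
    have h1 : ∑ w ∈ Fintype.piFinset S, (List.finRange (k + 1)).foldl (fun y l => f l (w l) y) x =
        ∑ z ∈ S 0 ×ˢ Fintype.piFinset (fun l => S (Fin.succ l)),
          (List.finRange k).foldl (fun y l => f l.succ (z.2 l) y) (f 0 z.1 x) := by
      symm
      refine Finset.sum_equiv (Fin.consEquiv fun _ => α) (fun z => ?_) fun z _ => ?_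
      · simp [Fintype.mem_piFinset, Fin.forall_fin_succ, Fin.consEquiv]
      · simp [List.finRange_succ, List.foldl_map, Fin.consEquiv]
    rw [h1, Finset.sum_product, List.finRange_succ, List.foldl_cons, List.foldl_map]
    have h2 := foldl_sum (List.finRange k) (fun l => ∑ a ∈ S (Fin.succ l), f l.succ a) (S 0)
      fun a => f 0 a x
    simp only [AddMonoidHom.finsetSum_apply] at h2
    rw [h2]
    exact Finset.sum_congr rfl fun a _ => ih (fun l => S l.succ) (fun l => f l.succ) (f 0 a x)

variable (K : Type*) [Field K] {n : ℕ}

/-- `M_{p,q}(σ, ·)` as a linear map. -/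
noncomputable def mulLift (p q : ℕ) (σ : Equiv.Perm (Fin n)) :
    MonoidAlgebra K (GVB n) →ₗ[K] MonoidAlgebra K (GVB n) where
  toFun := M K p q σ
  map_add' x y := by
    rw [M, M, M, MonoidAlgebra.coeff_add]
    exact Finsupp.sum_add_index' (by simp) (by simp [add_smul])
  map_smul' c x := by
    rw [M, M, MonoidAlgebra.coeff_smul, Finsupp.sum_smul_index (by simp)]
    simp [Finsupp.smul_sum, mul_smul]

open Classical in
/-- The operator `∑ M_{p,q}(σ, ·)`, the sum over all `(p,q)`-shuffles. -/
noncomputable def shuffleStep (p q : ℕ) :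
    MonoidAlgebra K (GVB n) →ₗ[K] MonoidAlgebra K (GVB n) :=
  ∑ σ : Equiv.Perm (Fin n) with IsShuffle 0 p q σ, mulLift K p q σ

/-- Thanks to this inclusion, a sum over all of 𝔖_{p,q} loses no shuffle on which the lift, extended
by zero, is nonzero. -/
theorem isShuffle_zero_of_isShuffle {a p q : ℕ} {σ : Equiv.Perm (Fin n)} (ha : a ≤ p)
    (h : IsShuffle a (p - a) q σ) : IsShuffle 0 p q σ := by
  refine ⟨fun i hi => h.1 i (by omega), fun i j _ hij hj => ?_,
    fun i j hi hij hj => h.2.2 i j (by omega) hij (by omega)⟩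
  have hij' : (i : ℕ) < j := hij
  rcases Nat.lt_or_ge i a with hia | hia
  · rw [h.1 i (Or.inl hia)]
    rcases Nat.lt_or_ge j a with hja | hja
    · rwa [h.1 j (Or.inl hja)]
    · have := h.le_apply hja
      exact Fin.lt_def.2 (by omega)
  · exact h.2.1 i j hia hij (by omega)

/-- On a single monoid element the step is left multiplication by a shuffle sum whose offset is the
virtual length, so the recursion for `shuffleSum` applies. -/
theorem shuffleStep_of {p : ℕ} (q : ℕ) {τ : GVB n} (hτ : GVB.virtualLength τ < p) :
    shuffleStep K p q (MonoidAlgebra.of K _ τ) =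
      shuffleSum K n (GVB.virtualLength τ) (p - GVB.virtualLength τ) q *
        MonoidAlgebra.of K _ τ := by
  classical
  have h1 : ∀ σ : Equiv.Perm (Fin n), mulLift K p q σ (MonoidAlgebra.of K _ τ) =
      Qshuffle K (GVB.virtualLength τ) (p - GVB.virtualLength τ) q σ *
        MonoidAlgebra.of K _ τ := by
    intro σ
    change M K p q σ (MonoidAlgebra.single τ 1) = _
    rw [M, MonoidAlgebra.coeff_single, Finsupp.sum_single_index (by simp), one_smul, Mbasis,
      if_pos hτ]
  rw [shuffleStep, LinearMap.sum_apply, Finset.sum_congr rfl fun σ _ => h1 σ, ← Finset.sum_mul]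
  congr 1
  simp only [Qshuffle]
  rw [← Finset.sum_filter, Finset.filter_filter, shuffleSum]
  refine Finset.sum_congr (Finset.filter_congr fun σ _ => ?_) fun _ _ => rfl
  exact and_iff_right_of_imp (isShuffle_zero_of_isShuffle hτ.le)

/-- Multiplying out is a bijection from sequences of shuffles to `desLE I`, and each `M` is linear
in its last argument, so the sum over permutations separates into one sum per stage. -/
theorem sum_QI (hn : 1 ≤ n) (I : Finset (Fin (n - 1))) :
    ∑ σ ∈ desLE I, QI K I σ =
      (List.finRange ((compositionOf I).length - 1)).foldl
        (fun x l => shuffleStep K (leftSize (compositionOf I) l) (rightSize (compositionOf I) l) x)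
        1 := by
  classical
  have hdes := mem_desLE_iff hn I
  have hP := monotone_blockEnd (compositionOf I)
  have hend := blockEnd_last hn (compositionOf I)
  have hdec := isShuffleDecomp_iff (compositionOf I)
  let S : Fin ((compositionOf I).length - 1) → Finset (Equiv.Perm (Fin n)) := fun l =>
    Finset.univ.filter fun σ =>
      IsShuffle 0 (leftSize (compositionOf I) l) (rightSize (compositionOf I) l) σ
  have h1 := sum_piFinset_foldl S (fun l σ => (mulLift K (leftSize (compositionOf I) l)
    (rightSize (compositionOf I) l) σ).toAddMonoidHom) 1
  have hS : ∀ w, w ∈ Fintype.piFinset S ↔ IsShuffleSeq (blockEnd (compositionOf I)) w := by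
    intro w
    have := hdec (List.ofFn w).reverse.prod w
    simp only [IsShuffleDecomp, and_congr_left_iff] at this
    simpa [S, Fintype.mem_piFinset] using this
  refine Eq.trans ?_ (h1.trans ?_)
  · symm
    refine Finset.sum_bij (fun w _ => (List.ofFn w).reverse.prod) (fun w hw => ?_)
      (fun w hw w' hw' he => ((hS w).1 hw).unique hP ((hS w').1 hw') he) (fun σ hσ => ?_)
      fun w hw => ?_
    · exact (hdes _).2 (((hS w).1 hw).isBlockMono hP)
    · obtain ⟨w, hw, hwσ⟩ := ((hdes σ).1 hσ).exists_isShuffleSeq hP hend.le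
      exact ⟨w, (hS w).2 hw, hwσ⟩
    · have hex : ∃ w', IsShuffleDecomp (compositionOf I) (List.ofFn w).reverse.prod w' :=
        ⟨w, (hdec _ w).2 ⟨(hS w).1 hw, rfl⟩⟩
      -- `QI` uses a chosen decomposition; uniqueness identifies it with `w`.
      rw [QI, dif_pos hex]
      have hch := (hdec _ _).1 hex.choose_spec
      rw [hch.1.unique hP ((hS w).1 hw) hch.2]
      rfl
  · simp only [shuffleStep, LinearMap.sum_apply]
    rfl

end IteratedSum

end GenMatsumotoTits

/-! ## The quasi-shuffle product behind a prefix -/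

namespace QuasiShuffle

open AugmentedBraidedAlgebra TensorPos

variable {K V : Type*} [Field K] [AddCommGroup V] [Module K V]

theorem consMap_tprod {N : ℕ} (g : (⨂[K]^N V) →ₗ[K] TensorAlgebra K V) (z : Fin (N + 1) → V) :
    consMap g (PiTensorProduct.tprod K z) =
      TensorAlgebra.ι K (z 0) * g (PiTensorProduct.tprod K (Fin.tail z)) := by
  simp [consMap, headTail]

theorem consMulMap_tprod {N : ℕ} (m : V ⊗[K] V →ₗ[K] V) (g : (⨂[K]^N V) →ₗ[K] TensorAlgebra K V)
    (z : Fin (N + 2) → V) :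
    consMulMap m g (PiTensorProduct.tprod K z) =
      TensorAlgebra.ι K (m (z 0 ⊗ₜ z 1)) *
        g (PiTensorProduct.tprod K (Fin.tail (Fin.tail z))) := by
  simp only [consMulMap, headTail, PiTensorProduct.lift.tprod]
  simp [-mul_eq_mul_right_iff]
  rfl

/-- The operator that deletes the tensorand in position `p` and replaces the next remaining
tensorand, in position `q` after the deletion, by the product of the two. -/
noncomputable def mulAt {N : ℕ} (m : V ⊗[K] V →ₗ[K] V) (p : Fin (N + 1)) (q : Fin N) :
    (⨂[K]^(N + 1) V) →ₗ[K] ⨂[K]^N V :=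
  PiTensorProduct.lift
    { toFun := fun z => PiTensorProduct.tprod K
        (Function.update (p.removeNth z) q (m (z p ⊗ₜ z (p.succAbove q))))
      map_update_add' := by
        intro inst z k x y
        obtain rfl : inst = instDecidableEqFin (N + 1) := Subsingleton.elim _ _
        rcases Fin.eq_self_or_eq_succAbove p k with rfl | ⟨k, rfl⟩
        · simp [TensorProduct.add_tmul]
        · rcases eq_or_ne k q with rfl | hk
          · simp [TensorProduct.tmul_add]
          · simp [Function.update_comm hk, hk.symm]
      map_update_smul' := by
        intro inst z k c x
        obtain rfl : inst = instDecidableEqFin (N + 1) := Subsingleton.elim _ _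
        rcases Fin.eq_self_or_eq_succAbove p k with rfl | ⟨k, rfl⟩
        · simp [← TensorProduct.smul_tmul']
        · rcases eq_or_ne k q with rfl | hk
          · simp
          · simp [Function.update_comm hk, hk.symm] }

theorem mulAt_tprod {N : ℕ} (m : V ⊗[K] V →ₗ[K] V) (p : Fin (N + 1)) (q : Fin N)
    (z : Fin (N + 1) → V) :
    mulAt m p q (PiTensorProduct.tprod K z) = PiTensorProduct.tprod K
      (Function.update (p.removeNth z) q (m (z p ⊗ₜ z (p.succAbove q)))) := by
  simp [mulAt]

/-- The merging term is split into a product taken inside the tensor, followed by keeping the merged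
tensorand as a prefix. In this form it can be compared with the action of a `ξ`. -/
theorem consMulMap_eq {N : ℕ} (m : V ⊗[K] V →ₗ[K] V) (g : (⨂[K]^N V) →ₗ[K] TensorAlgebra K V) :
    consMulMap m g = consMap g ∘ₗ mulAt m 0 0 := by
  apply PiTensorProduct.ext
  ext z
  simp only [LinearMap.compMultilinearMap_apply, LinearMap.comp_apply, consMulMap_tprod,
    mulAt_tprod, consMap_tprod]
  simp [Fin.removeNth_zero]

theorem consMap_comp_mulAt {N : ℕ} (m : V ⊗[K] V →ₗ[K] V) (p : Fin (N + 1)) (q : Fin N)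
    (g : (⨂[K]^N V) →ₗ[K] TensorAlgebra K V) :
    consMap (g ∘ₗ mulAt m p q) = consMap g ∘ₗ mulAt m p.succ q.succ := by
  apply PiTensorProduct.ext
  ext z
  simp only [LinearMap.compMultilinearMap_apply, LinearMap.comp_apply, mulAt_tprod, consMap_tprod]
  congr 3
  rw [Fin.tail_update_succ, Fin.succ_succAbove_succ]
  congr 1
  ext j
  exact congrArg z (Fin.succ_succAbove_succ p j).symm

theorem consMap_insertTwo {N : ℕ} (g : (⨂[K]^N V) →ₗ[K] TensorAlgebra K V) (z : Fin (N + 1) → V)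
    (i j : Fin N) (h : i ≠ j) (x : V ⊗[K] V) :
    consMap g (insertTwo z i.succ j.succ (by simpa using h) x) =
      TensorAlgebra.ι K (z 0) * g (insertTwo (Fin.tail z) i j h x) := by
  induction x with
  | zero => simp
  | add x y hx hy => simp [hx, hy, mul_add]
  | tmul a b =>
    rw [insertTwo_tmul, insertTwo_tmul, consMap_tprod, Fin.tail_update_succ, Fin.tail_update_succ,
      Function.update_of_ne (Fin.succ_ne_zero j).symm,
      Function.update_of_ne (Fin.succ_ne_zero i).symm]

theorem consMap_comp_local₂ {N : ℕ} (σ : V ⊗[K] V →ₗ[K] V ⊗[K] V) (i : ℕ) (h : 1 ≤ i ∧ i < N)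
    (h' : 1 ≤ i + 1 ∧ i + 1 < N + 1) (g : (⨂[K]^N V) →ₗ[K] TensorAlgebra K V) :
    consMap (g ∘ₗ local₂ σ i h) = consMap g ∘ₗ local₂ σ (i + 1) h' := by
  apply PiTensorProduct.ext
  ext z
  obtain ⟨i, rfl⟩ : ∃ j, i = j + 1 := ⟨i - 1, by omega⟩
  simp only [LinearMap.compMultilinearMap_apply, LinearMap.comp_apply, consMap_tprod]
  rw [local₂, local₂, actAt_tprod, actAt_tprod]
  exact (consMap_insertTwo g z ⟨i, by omega⟩ ⟨i + 1, by omega⟩ _ _).symm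

theorem consMap_comp_prod {N : ℕ} (σ : V ⊗[K] V →ₗ[K] V ⊗[K] V) (L : List ℕ) (hL : ∀ i ∈ L, 1 ≤ i)
    (g : (⨂[K]^N V) →ₗ[K] TensorAlgebra K V) :
    consMap (g ∘ₗ (L.map fun i => if h : 1 ≤ i ∧ i < N then local₂ σ i h else 1).prod) =
      consMap g ∘ₗ (L.map fun i => if h : 1 ≤ i + 1 ∧ i + 1 < N + 1 then local₂ σ (i + 1) h
        else 1).prod := by
  induction L generalizing g with
  | nil => rfl
  | cons i L ih =>
    rw [List.map_cons, List.map_cons, List.prod_cons, List.prod_cons, Module.End.mul_eq_comp,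
      Module.End.mul_eq_comp, ← LinearMap.comp_assoc, ih fun j hj => hL j (by simp [hj]),
      ← LinearMap.comp_assoc]
    congr 1
    by_cases h : 1 ≤ i ∧ i < N
    · rw [dif_pos h, dif_pos (by omega), consMap_comp_local₂]
    · have := hL i (by simp)
      rw [dif_neg h, dif_neg (by omega)]
      rfl

theorem consMap_comp_braidRun {N : ℕ} (σ : V ⊗[K] V →ₗ[K] V ⊗[K] V) {a : ℕ} (ha : 1 ≤ a) (b : ℕ)
    (g : (⨂[K]^N V) →ₗ[K] TensorAlgebra K V) :
    consMap (g ∘ₗ braidRun σ N a b) = consMap g ∘ₗ braidRun σ (N + 1) (a + 1) (b + 1) := by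
  rw [braidRun, braidRun, consMap_comp_prod σ _ fun i hi => ?_]
  · congr 2
    rw [show b + 1 + 1 - (a + 1) = b + 1 - a by omega, add_comm a 1, ← List.map_add_range', List.map_map]
    congr 1
    ext1 i
    simp only [Function.comp_apply, add_comm 1 i]
  · rw [List.mem_range'_1] at hi
    omega

theorem consMap_add {N : ℕ} (g g' : (⨂[K]^N V) →ₗ[K] TensorAlgebra K V) :
    consMap (g + g') = consMap g + consMap g' := by
  apply PiTensorProduct.ext
  ext z
  simp [consMap_tprod, mul_add]

/-- On `V^{⊗N}`: the first `b` tensorands are kept, and the next `p` tensorands are multiplied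
with the remaining `N - b - p` ones. -/
noncomputable def prefixProd (σ : V ⊗[K] V →ₗ[K] V ⊗[K] V) (m : V ⊗[K] V →ₗ[K] V) :
    (N b p : ℕ) → (⨂[K]^N V) →ₗ[K] TensorAlgebra K V
  | N, 0, p => prodAux σ m N p
  | 0, _ + 1, _ => TensorPower.toTensorAlgebra
  | N + 1, b + 1, p => consMap (prefixProd σ m N b p)

variable (σ : V ⊗[K] V →ₗ[K] V ⊗[K] V) (m : V ⊗[K] V →ₗ[K] V)

theorem prefixProd_zero (N p : ℕ) : prefixProd σ m N 0 p = prodAux σ m N p := by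
  cases N <;> rfl

theorem prefixProd_succ_succ (N b p : ℕ) :
    prefixProd σ m (N + 1) (b + 1) p = consMap (prefixProd σ m N b p) := rfl

theorem prodAux_of_trivial (N p : ℕ) (h : p = 0 ∨ N ≤ p) :
    prodAux σ m N p = TensorPower.toTensorAlgebra := by
  match N, p with
  | 0, _ => simp [prodAux]
  | 1, _ => simp [prodAux]
  | _ + 2, 0 => simp [prodAux]
  | N + 2, p + 1 => rw [prodAux, if_pos (by omega)]

theorem consMap_toTensorAlgebra (N : ℕ) :
    consMap (TensorPower.toTensorAlgebra : (⨂[K]^N V) →ₗ[K] TensorAlgebra K V) =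
      TensorPower.toTensorAlgebra := by
  apply PiTensorProduct.ext
  ext z
  simp [consMap_tprod, TensorAlgebra.tprod_apply, Fin.tail]

theorem prefixProd_of_trivial (N b p : ℕ) (h : p = 0 ∨ N ≤ b + p) :
    prefixProd σ m N b p = TensorPower.toTensorAlgebra := by
  induction b generalizing N with
  | zero => rw [prefixProd_zero, prodAux_of_trivial σ m N p (by omega)]
  | succ b ih =>
    cases N with
    | zero => rfl
    | succ N => rw [prefixProd_succ_succ, ih N (by omega), consMap_toTensorAlgebra]

/-- This is the defining recursion of the product carried behind `b` untouched tensorands, with all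
braid indices shifted by `b`. In each term the prefix grows by one, as the offset does in
`shuffleSum_succ_succ`; the third term also loses a tensorand, which on the other side becomes a
leading unit. -/
theorem prefixProd_succ_right (N b p : ℕ) (h : b + p < N) :
    prefixProd σ m (N + 1) b (p + 1) =
      prefixProd σ m (N + 1) (b + 1) p +
      prefixProd σ m (N + 1) (b + 1) (p + 1) ∘ₗ braidRun σ (N + 1) (b + 1) (b + p + 1) +
      prefixProd σ m N (b + 1) p ∘ₗ mulAt m ⟨b, by omega⟩ ⟨b, by omega⟩ ∘ₗ
        braidRun σ (N + 1) (b + 2) (b + p + 1) := by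
  induction b generalizing N with
  | zero =>
    obtain ⟨N, rfl⟩ : ∃ N', N = N' + 1 := ⟨N - 1, by omega⟩
    simp only [prefixProd_succ_succ, prefixProd_zero]
    rw [prodAux, if_neg (by omega), consMulMap_eq, zero_add, zero_add, zero_add]
    rfl
  | succ b ih =>
    obtain ⟨N, rfl⟩ : ∃ N', N = N' + 1 := ⟨N - 1, by omega⟩
    rw [prefixProd_succ_succ, ih N (by omega), consMap_add, consMap_add,
      consMap_comp_braidRun σ (by omega), ← LinearMap.comp_assoc (braidRun σ (N + 1) (b + 2) _),
      consMap_comp_braidRun σ (by omega), consMap_comp_mulAt]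
    rw [show b + 1 + p + 1 = b + p + 1 + 1 by omega]
    rfl

end QuasiShuffle

/-! ## Tensors with leading units -/

namespace AugmentedBraidedAlgebra

open TensorPos QuasiShuffle GenMatsumotoTits

variable {K W : Type*} [Field K] [AddCommGroup W] [Module K W] (A : AugmentedBraidedAlgebra K W)
  {n : ℕ}

/-- The sequence `1, …, 1, z₁, …, z_N, v_{l+N+1}, …, v_n`. -/
def padFun (v : Fin n → A.V) (l : ℕ) {N : ℕ} (z : Fin N → A.V) (i : Fin n) : W :=
  if (i : ℕ) < l then A.one else if h : (i : ℕ) - l < N then z ⟨i - l, h⟩ else v i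

theorem padFun_update (v : Fin n → A.V) {l N : ℕ} (h : l + N ≤ n) (z : Fin N → A.V) (k : Fin N)
    (x : A.V) : A.padFun v l (Function.update z k x) =
      Function.update (A.padFun v l z) ⟨l + k, by omega⟩ (x : W) := by
  funext i
  rcases eq_or_ne i ⟨l + k, by omega⟩ with rfl | hi
  · simp [padFun]
  · rw [Function.update_of_ne hi]
    simp only [padFun]
    split_ifs with h1 h2
    · rfl
    · rw [Function.update_of_ne]
      intro hk
      apply hi
      rw [Fin.ext_iff] at hk ⊢
      simp only at hk ⊢
      omega
    · rfl

/-- The map `V^{⊗N} → W^{⊗n}`, `z ↦ 1 ⊗ ⋯ ⊗ 1 ⊗ z ⊗ v_{l+N+1} ⊗ ⋯ ⊗ v_n`. -/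
noncomputable def pad (v : Fin n → A.V) (l N : ℕ) (h : l + N ≤ n) :
    (⨂[K]^N A.V) →ₗ[K] ⨂[K]^n W :=
  PiTensorProduct.lift
    { toFun := fun z => PiTensorProduct.tprod K (A.padFun v l z)
      map_update_add' := by
        intro inst z k x y
        obtain rfl : inst = instDecidableEqFin N := Subsingleton.elim _ _
        simp [A.padFun_update v h]
      map_update_smul' := by
        intro inst z k c x
        obtain rfl : inst = instDecidableEqFin N := Subsingleton.elim _ _
        simp [A.padFun_update v h] }

theorem pad_tprod (v : Fin n → A.V) {l N : ℕ} (h : l + N ≤ n) (z : Fin N → A.V) :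
    A.pad v l N h (PiTensorProduct.tprod K z) = PiTensorProduct.tprod K (A.padFun v l z) := by
  simp [pad]

theorem padFun_apply (v : Fin n → A.V) {l N : ℕ} (h : l + N ≤ n) (z : Fin N → A.V) (k : Fin N) :
    A.padFun v l z ⟨l + k, by omega⟩ = z k := by
  simp [padFun]

theorem pad_insertTwo (v : Fin n → A.V) {l N : ℕ} (h : l + N ≤ n) (z : Fin N → A.V)
    (i j : Fin N) (hij : i ≠ j) (x : A.V ⊗[K] A.V) :
    A.pad v l N h (insertTwo z i j hij x) =
      insertTwo (A.padFun v l z) ⟨l + i, by omega⟩ ⟨l + j, by omega⟩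
        (by simpa [Fin.ext_iff] using hij) (TensorProduct.map A.V.subtype A.V.subtype x) := by
  induction x with
  | zero => simp
  | add x y hx hy => simp only [map_add, hx, hy]
  | tmul a b =>
    rw [insertTwo_tmul, pad_tprod, A.padFun_update v h, A.padFun_update v h,
      TensorProduct.map_tmul, insertTwo_tmul]
    rfl

theorem rep_sig {i : ℕ} (h : 1 ≤ i ∧ i < n) : A.rep n (GVB.sig n i) = local₂ A.σ i h := by
  rw [GVB.sig, dif_pos h]
  rfl

theorem rep_xi {i : ℕ} (h : 1 ≤ i ∧ i < n) : A.rep n (GVB.xi n i) = local₂ A.σm i h := by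
  rw [GVB.xi, dif_pos h]
  rfl

/-- The braiding restricts to `V`, and the `l` leading units only shift the position. -/
theorem rep_sig_pad (v : Fin n → A.V) {l N : ℕ} (h : l + N ≤ n) {i : ℕ} (hi : 1 ≤ i ∧ i < N)
    (z : ⨂[K]^N A.V) :
    A.rep n (GVB.sig n (l + i)) (A.pad v l N h z) = A.pad v l N h (local₂ A.σV i hi z) := by
  rw [A.rep_sig (by omega)]
  rw [← LinearMap.comp_apply, ← LinearMap.comp_apply]
  refine LinearMap.congr_fun (PiTensorProduct.ext ?_) z
  ext z
  obtain ⟨i, rfl⟩ : ∃ j, i = j + 1 := ⟨i - 1, by omega⟩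
  simp only [LinearMap.compMultilinearMap_apply, LinearMap.comp_apply, pad_tprod]
  rw [local₂, local₂, actAt_tprod, actAt_tprod, A.pad_insertTwo v h, A.σV_spec,
    TensorProduct.map_tmul]
  simp only [Submodule.subtype_apply]
  rw [← A.padFun_apply v h z ⟨i + 1 - 1, by omega⟩, ← A.padFun_apply v h z ⟨i + 1, by omega⟩]
  rfl

theorem rep_ascProd_pad (v : Fin n → A.V) {l N : ℕ} (h : l + N ≤ n) {a b : ℕ} (ha : 1 ≤ a)
    (hb : b < N) (z : ⨂[K]^N A.V) :
    A.rep n (ascProd (GVB.sig n) (l + a) (l + b)) (A.pad v l N h z) =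
      A.pad v l N h (braidRun A.σV N a b z) := by
  have hrun : ∀ a, braidRun A.σV N a b =
      ascProd (fun i => if h : 1 ≤ i ∧ i < N then local₂ A.σV i h else 1) a b := fun _ => rfl
  rw [hrun]
  induction hd : b + 1 - a generalizing a with
  | zero =>
    rw [ascProd_of_lt _ (by omega), ascProd_of_lt _ (by omega), map_one]
    rfl
  | succ d ih =>
    rw [ascProd_eq_mul _ (by omega), ascProd_eq_mul _ (show a ≤ b by omega), map_mul,
      Module.End.mul_apply, Module.End.mul_apply, dif_pos ⟨ha, by omega⟩, ← A.rep_sig_pad,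
      ← ih (a := a + 1) (by omega) (by omega)]
    rfl

/-- A tensorand `1` moves to the left by `σ_{c+1} ⋯ σ_a`. -/
theorem rep_ascProd_tprod {a c : ℕ} (hca : c ≤ a) (ha : a < n) (f : Fin n → W)
    (hf : f ⟨a, ha⟩ = A.one) :
    A.rep n (ascProd (GVB.sig n) (c + 1) a) (PiTensorProduct.tprod K f) =
      PiTensorProduct.tprod K fun i : Fin n => if (i : ℕ) = c then A.one
        else if c < i ∧ (i : ℕ) ≤ a then f ⟨i - 1, by omega⟩ else f i := by
  induction hd : a - c generalizing c with
  | zero =>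
    obtain rfl : c = a := by omega
    rw [ascProd_of_lt _ (by omega), map_one, Module.End.one_apply]
    congr 1
    funext i
    split_ifs with h1 h2
    · rw [← hf]
      exact congrArg f (Fin.ext h1)
    · omega
    · rfl
  | succ d ih =>
    rw [ascProd_eq_mul _ (by omega), map_mul, Module.End.mul_apply,
      ih (c := c + 1) (by omega) (by omega), A.rep_sig (by omega), local₂, actAt_tprod]
    simp only [Nat.add_sub_cancel, ite_true]
    rw [A.braid_one_right, insertTwo_tmul]
    congr 1
    funext i
    by_cases h1 : (i : ℕ) = c
    · have hi : i = ⟨c, by omega⟩ := Fin.ext h1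
      rw [hi]
      simp [Fin.ext_iff]
    · by_cases h2 : (i : ℕ) = c + 1
      · have hi : i = ⟨c + 1, by omega⟩ := Fin.ext h2
        rw [hi]
        simp
        omega
      · rw [Function.update_of_ne (by simpa [Fin.ext_iff] using h2),
          Function.update_of_ne (by simpa [Fin.ext_iff] using h1)]
        simp only [h1, h2, if_false]
        split_ifs <;> first | rfl | omega

/-- The letter `ξ` puts a unit in front of the product of two neighbours. The run of `σ`'s then
carries this unit to the very front by `σ (x ⊗ 1) = 1 ⊗ x`, so it joins the leading units. -/
theorem rep_xi_pad (v : Fin n → A.V) {l N b : ℕ} (h : l + (N + 1) ≤ n) (h' : l + 1 + N ≤ n)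
    (hb : b < N) (z : ⨂[K]^(N + 1) A.V) :
    A.rep n (ascProd (GVB.sig n) 1 (l + b) * GVB.xi n (l + b + 1)) (A.pad v l (N + 1) h z) =
      A.pad v (l + 1) N h' (mulAt A.mV ⟨b, by omega⟩ ⟨b, hb⟩ z) := by
  rw [← LinearMap.comp_apply, ← LinearMap.comp_apply]
  refine LinearMap.congr_fun (PiTensorProduct.ext ?_) z
  ext z
  simp only [LinearMap.compMultilinearMap_apply, LinearMap.comp_apply, pad_tprod, mulAt_tprod]
  have hz0 : A.padFun v l z ⟨l + b, by omega⟩ = z ⟨b, by omega⟩ :=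
    A.padFun_apply v h z ⟨b, by omega⟩
  have hz1 : A.padFun v l z ⟨l + b + 1, by omega⟩ = z ⟨b + 1, by omega⟩ :=
    A.padFun_apply v h z ⟨b + 1, by omega⟩
  have hm : A.m ((z ⟨b, by omega⟩ : W) ⊗ₜ (z ⟨b + 1, by omega⟩ : W)) =
      A.mV (z ⟨b, by omega⟩ ⊗ₜ z ⟨b + 1, by omega⟩) := by
    rw [A.mV_spec, TensorProduct.map_tmul]
    rfl
  have hsucc : (⟨b, by omega⟩ : Fin (N + 1)).succAbove ⟨b, hb⟩ = ⟨b + 1, by omega⟩ := by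
    rw [Fin.succAbove_of_le_castSucc _ _ (by simp)]
    rfl
  rw [map_mul, Module.End.mul_apply, A.rep_xi (by omega), local₂, actAt_tprod]
  simp only [Nat.add_sub_cancel, hz0, hz1, σm, LinearMap.comp_apply, TensorProduct.mk_apply, hm]
  rw [insertTwo_tmul, A.rep_ascProd_tprod (c := 0) (Nat.zero_le _) (by omega)]
  -- Position by position: 0 receives the new unit, positions up to `l + b` are shifted by one, `l +
  -- b + 1` holds the product, and the later ones are unchanged.
  · congr 1
    funext i
    by_cases h0 : (i : ℕ) = 0
    · simp [h0, padFun]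
    simp only [h0, if_false]
    by_cases h1 : (i : ℕ) ≤ l + b
    · rw [if_pos ⟨by omega, h1⟩, Function.update_of_ne (by simp [Fin.ext_iff]; omega),
        Function.update_of_ne (by simp [Fin.ext_iff]; omega)]
      simp only [padFun]
      by_cases h2 : (i : ℕ) < l + 1
      · rw [if_pos h2, if_pos (by omega)]
      · rw [if_neg h2, if_neg (by omega), dif_pos (by omega), dif_pos (by omega),
          Function.update_of_ne (by simp [Fin.ext_iff]; omega), Fin.removeNth,
          Fin.succAbove_of_castSucc_lt _ _ (by simp [Fin.lt_def]; omega)]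
        congr 2
        ext
        simp
        omega
    · rw [if_neg (by omega)]
      by_cases h2 : (i : ℕ) = l + b + 1
      · have hi : i = ⟨l + b + 1, by omega⟩ := Fin.ext h2
        rw [hi, hsucc, Function.update_self]
        simp only [padFun]
        have h3 : l + b + 1 - (l + 1) = b := by omega
        simp only [h3]
        rw [if_neg (by omega), dif_pos hb, Function.update_self]
      · rw [Function.update_of_ne (by simpa [Fin.ext_iff] using h2),
          Function.update_of_ne (by simp [Fin.ext_iff]; omega)]
        simp only [padFun]
        rw [if_neg (by omega), if_neg (by omega)]
        by_cases h3 : (i : ℕ) - (l + 1) < N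
        · rw [dif_pos h3, dif_pos (by omega),
            Function.update_of_ne (by simp [Fin.ext_iff]; omega), Fin.removeNth,
            Fin.succAbove_of_le_castSucc _ _ (by simp [Fin.le_def]; omega)]
          congr 2
          ext
          simp
          omega
        · rw [dif_neg h3, dif_neg (by omega)]
  · rw [Function.update_of_ne (by simp [Fin.ext_iff]), Function.update_self]

theorem delete_pad (v : Fin n → A.V) {l N : ℕ} (h : l + N = n) (z : ⨂[K]^N A.V) :
    A.delete (TensorPower.toTensorAlgebra (A.pad v l N h.le z)) =
      TensorPower.toTensorAlgebra z := by
  subst h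
  rw [← LinearMap.comp_apply, ← LinearMap.comp_apply]
  refine LinearMap.congr_fun (PiTensorProduct.ext ?_) z
  ext z
  simp only [LinearMap.compMultilinearMap_apply, LinearMap.comp_apply, pad_tprod,
    TensorPower.toTensorAlgebra_tprod, TensorAlgebra.tprod_apply, delete, AlgHom.toLinearMap_apply,
    map_list_prod, List.map_ofFn, Function.comp_def, TensorAlgebra.lift_ι_apply]
  rw [List.ofFn_add, List.prod_append]
  have h1 : ∀ i : Fin l, A.deleteOne (A.padFun v l z (Fin.castLE (Nat.le_add_right l N) i)) = 1 := by
    intro i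
    rw [padFun, if_pos (by simp), A.deleteOne_one]
  have h2 : ∀ i : Fin N, A.deleteOne (A.padFun v l z (Fin.natAdd l i)) =
      TensorAlgebra.ι K (z i) := by
    intro i
    rw [← A.deleteOne_coe, ← A.padFun_apply v le_rfl z i]
    rfl
  simp only [h1, h2]
  simp

end AugmentedBraidedAlgebra

/-! ### Virtual length of the words in the lift -/

namespace GVB

variable {n : ℕ}

theorem virtualLength_one : virtualLength (1 : GVB n) = 0 := by
  rw [virtualLength, map_one]
  rfl

theorem virtualLength_mul (τ τ' : GVB n) :
    virtualLength (τ * τ') = virtualLength τ + virtualLength τ' := by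
  simp only [virtualLength, map_mul]
  rfl

theorem virtualLength_sig (i : ℕ) : virtualLength (sig n i) = 0 := by
  rw [sig]
  split_ifs
  · rfl
  · exact virtualLength_one

theorem virtualLength_xi {i : ℕ} (h : 1 ≤ i ∧ i < n) : virtualLength (xi n i) = 1 := by
  rw [xi, dif_pos h]
  rfl

theorem virtualLength_ascProd_sig (a b : ℕ) :
    virtualLength (GenMatsumotoTits.ascProd (sig n) a b) = 0 := by
  rw [GenMatsumotoTits.ascProd]
  induction List.range' a (b + 1 - a) with
  | nil => exact virtualLength_one
  | cons i L ih => rw [List.map_cons, List.prod_cons, virtualLength_mul, ih, virtualLength_sig]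

end GVB

/-! ### The product on homogeneous tensors and on blocks -/

namespace QuasiShuffle

variable {K V : Type*} [Field K] [AddCommGroup V] [Module K V]

theorem toDirectSum_toTensorAlgebra {N : ℕ} (z : ⨂[K]^N V) :
    TensorAlgebra.toDirectSum (TensorPower.toTensorAlgebra z) =
      DirectSum.lof K ℕ (fun n => ⨂[K]^n V) N z := by
  have h : TensorPower.toTensorAlgebra z =
      TensorAlgebra.ofDirectSum (DirectSum.of (fun n => ⨂[K]^n V) N z) :=
    (DirectSum.toAddMonoid_of
      (fun _ => LinearMap.toAddMonoidHom TensorPower.toTensorAlgebra) _ _).symm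
  rw [h, TensorAlgebra.toDirectSum_ofDirectSum]
  rfl

theorem qqsMul_toTensorAlgebra (σ : V ⊗[K] V →ₗ[K] V ⊗[K] V) (m : V ⊗[K] V →ₗ[K] V) {p q : ℕ}
    (z : ⨂[K]^p V) (w : ⨂[K]^q V) :
    qqsMul σ m (TensorPower.toTensorAlgebra z) (TensorPower.toTensorAlgebra w) =
      prodAux σ m (p + q) p (TensorPower.mulEquiv (z ⊗ₜ w)) := by
  rw [qqsMul, LinearMap.compl₁₂_apply, AlgHom.toLinearMap_apply, AlgHom.toLinearMap_apply,
    toDirectSum_toTensorAlgebra, toDirectSum_toTensorAlgebra, DirectSum.toModule_lof,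
    LinearMap.flip_apply, DirectSum.toModule_lof, LinearMap.flip_apply]
  rfl

theorem leftStar_ofFn (σ : V ⊗[K] V →ₗ[K] V ⊗[K] V) (m : V ⊗[K] V →ₗ[K] V) {r : ℕ} (hr : 0 < r)
    (g : Fin r → TensorAlgebra K V) :
    leftStar σ m (List.ofFn g) = (List.finRange (r - 1)).foldl
      (fun y (l : Fin (r - 1)) => qqsMul σ m y (g ⟨l + 1, by omega⟩)) (g ⟨0, hr⟩) := by
  obtain ⟨r, rfl⟩ : ∃ k, r = k + 1 := ⟨r - 1, by omega⟩
  rw [List.ofFn_succ, leftStar, List.ofFn_eq_map, List.foldl_map]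
  rfl

end QuasiShuffle

/-- A loop invariant for two folds run in parallel: here the iterated lifts in `K[GVB_n⁺]` and the
iterated product in `T(V)`. -/
theorem List.foldl_finRange_rel {α β : Type*} {k : ℕ} (R : ℕ → α → β → Prop) (f : Fin k → α → α)
    (g : Fin k → β → β) {x : α} {y : β} (h0 : R 0 x y)
    (hs : ∀ (l : Fin k) (x : α) (y : β), R l x y → R (l + 1) (f l x) (g l y)) :
    R k ((List.finRange k).foldl (fun x l => f l x) x)
      ((List.finRange k).foldl (fun y l => g l y) y) := by
  induction k generalizing R x y with
  | zero => exact h0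
  | succ k ih =>
    rw [List.finRange_succ, List.foldl_cons, List.foldl_cons, List.foldl_map, List.foldl_map]
    exact ih (fun m => R (m + 1)) (fun l => f l.succ) (fun l => g l.succ) (hs 0 x y h0)
      fun l x y h => hs l.succ x y h

/-! ### The invariant linking lifts and products -/

namespace AugmentedBraidedAlgebra

open TensorPos QuasiShuffle GenMatsumotoTits

variable {K W : Type*} [Field K] [AddCommGroup W] [Module K W] (A : AugmentedBraidedAlgebra K W)
  {n : ℕ}

/-- The next block of `v` already stands behind `z` in the padded tensor; only the boundary between
active and untouched tensorands moves. -/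
theorem pad_mulEquiv (v : Fin n → A.V) {l N q : ℕ} (h : l + N ≤ n) (h' : l + (N + q) ≤ n)
    (z : ⨂[K]^N A.V) :
    A.pad v l (N + q) h' (TensorPower.mulEquiv
      (z ⊗ₜ PiTensorProduct.tprod K fun j : Fin q => v ⟨l + N + j, by omega⟩)) =
      A.pad v l N h z := by
  refine LinearMap.congr_fun (f := A.pad v l (N + q) h' ∘ₗ TensorPower.mulEquiv.toLinearMap ∘ₗ
    (TensorProduct.mk K _ _).flip (PiTensorProduct.tprod K fun j : Fin q => v ⟨l + N + j, by omega⟩))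
    (PiTensorProduct.ext ?_) z
  ext z
  simp only [LinearMap.compMultilinearMap_apply, LinearMap.comp_apply, LinearMap.flip_apply,
    TensorProduct.mk_apply, LinearEquiv.coe_coe, pad_tprod]
  rw [← TensorPower.gMul_def, TensorPower.tprod_mul_tprod, pad_tprod]
  congr 1
  funext i
  simp only [padFun]
  by_cases h1 : (i : ℕ) < l
  · rw [if_pos h1, if_pos h1]
  rw [if_neg h1, if_neg h1]
  by_cases h2 : (i : ℕ) - l < N
  · rw [dif_pos h2, dif_pos (by omega)]
    exact congrArg Subtype.val (Fin.append_left z _ ⟨i - l, h2⟩)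
  · rw [dif_neg h2]
    by_cases h3 : (i : ℕ) - l < N + q
    · rw [dif_pos h3]
      have hi : (⟨i - l, h3⟩ : Fin (N + q)) = Fin.natAdd N ⟨i - l - N, by omega⟩ :=
        Fin.ext (by simp; omega)
      rw [hi, Fin.append_right]
      congr 2
      exact Fin.ext (by simp; omega)
    · rw [dif_neg h3]

/-- The pairs of an element `x` of `K[GVB_n⁺]` and an element `y` of `T(V)` such that every element
`τ` of the monoid in `x` sends `v₁ ⊗ ⋯ ⊗ vₙ` to a tensor `1 ⊗ ⋯ ⊗ 1 ⊗ z ⊗ v_{P+1} ⊗ ⋯ ⊗ vₙ` with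
`l_v(τ)` leading units, and `y` is the corresponding combination of the tensors `z`. -/
noncomputable def tracked (v : Fin n → A.V) (P : ℕ) :
    Submodule K (MonoidAlgebra K (GVB n) × TensorAlgebra K A.V) :=
  Submodule.span K {x | ∃ (τ : GVB n) (l N : ℕ) (h : l + N ≤ n) (z : ⨂[K]^N A.V),
    GVB.virtualLength τ = l ∧ 1 ≤ N ∧ l + N = P ∧
    A.rep n τ (PiTensorProduct.tprod K fun i => (v i : W)) = A.pad v l N h z ∧
    x = (MonoidAlgebra.of K _ τ, TensorPower.toTensorAlgebra z)}

theorem of_ascProd_sig (a b : ℕ) :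
    MonoidAlgebra.of K _ (ascProd (GVB.sig n) a b) = ascProd (sigA K n) a b :=
  map_ascProd _ _ _ _

/-- The two three-term recursions are matched term by term, with offset `l + b`. The word attached
to each term is absorbed into `τ`, and its effect into `z`, so the induction must run over all `τ`,
`z`, `l`, `b`. It is on a bound for `p + q`, because the terms lower this sum by one or two. -/
theorem shuffleSum_mem_tracked (v : Fin n → A.V) {p q b l N : ℕ} (τ : GVB n) (z : ⨂[K]^N A.V)
    (hN : N = b + p + q) (hN1 : 1 ≤ N) (h : l + N ≤ n) (hl : GVB.virtualLength τ = l)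
    (hτ : A.rep n τ (PiTensorProduct.tprod K fun i => (v i : W)) = A.pad v l N h z) :
    (shuffleSum K n (l + b) p q * MonoidAlgebra.of K _ τ, prefixProd A.σV A.mV N b p z) ∈
      A.tracked v (l + N) := by
  obtain ⟨d, hd⟩ : ∃ d, p + q ≤ d := ⟨_, le_rfl⟩
  induction d generalizing p q b l N τ with
  | zero =>
    obtain rfl : p = 0 := by omega
    rw [shuffleSum_zero_left, _root_.one_mul, prefixProd_of_trivial _ _ _ _ _ (Or.inl rfl)]
    exact Submodule.subset_span ⟨τ, l, N, h, z, hl, hN1, rfl, hτ, rfl⟩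
  | succ d ih =>
    cases p with
    | zero =>
      rw [shuffleSum_zero_left, _root_.one_mul, prefixProd_of_trivial _ _ _ _ _ (Or.inl rfl)]
      exact Submodule.subset_span ⟨τ, l, N, h, z, hl, hN1, rfl, hτ, rfl⟩
    | succ p =>
      cases q with
      | zero =>
        rw [shuffleSum_zero_right, _root_.one_mul,
          prefixProd_of_trivial _ _ _ _ _ (Or.inr (by omega))]
        exact Submodule.subset_span ⟨τ, l, N, h, z, hl, hN1, rfl, hτ, rfl⟩
      | succ q =>
        obtain ⟨N, rfl⟩ : ∃ N', N = N' + 1 := ⟨N - 1, by omega⟩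
        have hrun : ∀ c, 1 ≤ c → A.rep n (ascProd (GVB.sig n) (l + c) (l + (b + p + 1)) * τ)
            (PiTensorProduct.tprod K fun i => (v i : W)) =
              A.pad v l (N + 1) h (braidRun A.σV (N + 1) c (b + p + 1) z) := by
          intro c hc
          rw [map_mul, Module.End.mul_apply, hτ, A.rep_ascProd_pad v h hc (by omega)]
        have hlrun : ∀ c, GVB.virtualLength
            (ascProd (GVB.sig n) (l + c) (l + (b + p + 1)) * τ) = l := by
          intro c
          rw [GVB.virtualLength_mul, GVB.virtualLength_ascProd_sig, zero_add, hl]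
        have h1 := ih (p := p) (q := q + 1) (b := b + 1) τ z (by omega) hN1 h hl hτ (by omega)
        have h2 := ih (p := p + 1) (q := q) (b := b + 1) _ _ (by omega) hN1 h (hlrun (b + 1))
          (hrun (b + 1) (by omega)) (by omega)
        -- The merging term: one tensorand becomes a leading unit, so `l` rises and the degree of
        -- `z` falls while their sum is kept. With `b` also raised, the offset becomes `l + b + 2`.
        have h3 := ih (p := p) (q := q) (b := b + 1) (l := l + 1)
          ((ascProd (GVB.sig n) 1 (l + b) * GVB.xi n (l + b + 1)) *
            (ascProd (GVB.sig n) (l + (b + 2)) (l + (b + p + 1)) * τ))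
          (mulAt A.mV ⟨b, by omega⟩ ⟨b, by omega⟩
            (braidRun A.σV (N + 1) (b + 2) (b + p + 1) z))
          (by omega) (by omega) (by omega)
          (by
            rw [GVB.virtualLength_mul, hlrun, GVB.virtualLength_mul,
              GVB.virtualLength_ascProd_sig, GVB.virtualLength_xi ⟨by omega, by omega⟩]
            omega)
          (by
            rw [map_mul, Module.End.mul_apply, hrun _ (by omega),
              A.rep_xi_pad v h (by omega) (by omega)])
          (by omega)
        rw [show l + 1 + N = l + (N + 1) by omega] at h3
        convert add_mem (add_mem h1 h2) h3 using 1
        rw [prefixProd_succ_right _ _ _ _ _ (by omega), shuffleSum_succ_succ K _ _ _ (by omega)]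
        simp only [map_mul, of_ascProd_sig, Prod.mk_add_mk, LinearMap.add_apply,
          LinearMap.comp_apply, add_mul]
        rw [show l + 1 + (b + 1) = l + b + 2 by omega]
        simp only [xiA, mul_assoc, add_assoc]

/-- Both components are linear, so generators suffice. For a generator, the next block is appended
to `z` and `shuffleSum_mem_tracked` is applied with no kept prefix. -/
theorem shuffleStep_mem_tracked (v : Fin n → A.V) {P q : ℕ} (h : P + q ≤ n)
    {x : MonoidAlgebra K (GVB n) × TensorAlgebra K A.V} (hx : x ∈ A.tracked v P) :
    (shuffleStep K P q x.1, qqsMul A.σV A.mV x.2 (TensorAlgebra.tprod K A.V q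
      fun j => v ⟨P + j, by omega⟩)) ∈ A.tracked v (P + q) := by
  refine (Submodule.span_le (p := (A.tracked v (P + q)).comap ((shuffleStep K P q).prodMap
    ((qqsMul A.σV A.mV).flip (TensorAlgebra.tprod K A.V q fun j => v ⟨P + j, by omega⟩))))).2
    ?_ hx
  rintro _ ⟨τ, l, N, hl', z, hl, hN, rfl, hτ, rfl⟩
  have h1 := A.shuffleSum_mem_tracked v (p := N) (q := q) (b := 0) (l := l) τ _ (by omega)
    (by omega) (by omega) hl (hτ.trans (A.pad_mulEquiv v (q := q) hl' (by omega) z).symm)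
  rw [prefixProd_zero, ← qqsMul_toTensorAlgebra, TensorPower.toTensorAlgebra_tprod] at h1
  -- The condition `1 ≤ N` in `tracked` gives `l < P`, which is what keeps `M` out of its zero case.
  rw [SetLike.mem_coe, Submodule.mem_comap, LinearMap.prodMap_apply, LinearMap.flip_apply,
    shuffleStep_of K q (by omega), hl, Nat.add_sub_cancel_left, add_assoc]
  exact h1

theorem one_mem_tracked (v : Fin n → A.V) (c : Composition n) (hc : 0 < c.length) :
    (1, TensorAlgebra.tprod K A.V (c.blocksFun ⟨0, hc⟩) (v ∘ c.embedding ⟨0, hc⟩)) ∈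
      A.tracked v (blockEnd c 0) := by
  have hsize : blockEnd c 0 = c.blocksFun ⟨0, hc⟩ := by
    rw [blockEnd, c.sizeUpTo_succ hc, c.sizeUpTo_zero, zero_add]
    rfl
  have hle : blockEnd c 0 ≤ n := c.sizeUpTo_le 1
  refine Submodule.subset_span ⟨1, 0, _, by omega, PiTensorProduct.tprod K
    (v ∘ c.embedding ⟨0, hc⟩), GVB.virtualLength_one, c.one_le_blocksFun _, by omega, ?_, ?_⟩
  · rw [map_one, Module.End.one_apply, pad_tprod]
    congr 1
    funext i
    simp only [padFun]
    rw [if_neg (by omega)]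
    split_ifs with hi
    · simp only [Function.comp_apply]
      congr 2
      ext
      simp [Composition.coe_embedding]
    · rfl
  · rw [map_one, TensorPower.toTensorAlgebra_tprod]

theorem delete_eq_of_mem_tracked (v : Fin n → A.V)
    {x : MonoidAlgebra K (GVB n) × TensorAlgebra K A.V} (hx : x ∈ A.tracked v n) :
    A.delete (TensorPower.toTensorAlgebra
      (A.algRep n x.1 (PiTensorProduct.tprod K fun i => (v i : W)))) = x.2 := by
  induction hx using Submodule.span_induction with
  | mem x hx =>
    obtain ⟨τ, l, N, h, z, hl, hN, hP, hτ, rfl⟩ := hx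
    simp only [algRep, MonoidAlgebra.lift_of, hτ]
    exact A.delete_pad v hP z
  | zero => simp
  | add x y _ _ hx hy => simp only [Prod.fst_add, Prod.snd_add, map_add, LinearMap.add_apply, hx, hy]
  | smul c x _ hx => simp only [Prod.smul_fst, Prod.smul_snd, map_smul, LinearMap.smul_apply, hx]

end AugmentedBraidedAlgebra

/-! ### The theorem -/

theorem theorem4p2 {K W : Type*} [Field K] [AddCommGroup W] [Module K W]
    (A : AugmentedBraidedAlgebra K W) (n : ℕ) (hn : 1 ≤ n) (I : Finset (Fin (n - 1)))
    (v : Fin n → A.V) :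
    QuasiShuffle.blockProduct A.σV A.mV (GenMatsumotoTits.compositionOf I) v =
      A.delete (TensorPower.toTensorAlgebra
        (∑ σ ∈ GenMatsumotoTits.desLE I,
          A.algRep n (GenMatsumotoTits.QI K I σ)
            (PiTensorProduct.tprod K fun i => (v i : W)))) := by
  rw [← LinearMap.sum_apply, ← map_sum, GenMatsumotoTits.sum_QI K hn]
  have hpos := GenMatsumotoTits.length_compositionOf_pos hn I
  generalize GenMatsumotoTits.compositionOf I = c at *
  rw [QuasiShuffle.blockProduct, QuasiShuffle.leftStar_ofFn _ _ hpos]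
  refine (A.delete_eq_of_mem_tracked v (x := (_, _)) ?_).symm
  -- After `m` steps the invariant holds for the first `m + 1` blocks; it starts with the identity
  -- of the monoid and the first block.
  have key := List.foldl_finRange_rel
    (fun m x y => (x, y) ∈ A.tracked v (GenMatsumotoTits.blockEnd c m))
    (fun l x => GenMatsumotoTits.shuffleStep K (GenMatsumotoTits.leftSize c l)
      (GenMatsumotoTits.rightSize c l) x)
    (fun (l : Fin (c.length - 1)) y => QuasiShuffle.qqsMul A.σV A.mV y
      (TensorAlgebra.tprod K A.V (c.blocksFun ⟨l + 1, by omega⟩)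
        (v ∘ c.embedding ⟨l + 1, by omega⟩)))
    (A.one_mem_tracked v c hpos) fun l x y h => ?_
  · simpa only [GenMatsumotoTits.blockEnd_last hn c] using key
  · have hle : GenMatsumotoTits.leftSize c l + GenMatsumotoTits.rightSize c l ≤ n := by
      rw [← GenMatsumotoTits.blockEnd_succ]
      exact c.sizeUpTo_le _
    have := A.shuffleStep_mem_tracked v hle h
    rw [← GenMatsumotoTits.blockEnd_succ] at this
    exact this
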